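/- Let $k\ge 1$, $q\ge 0$ be integers and $p=k+q$. Let $S\in\mathbb{R}^{p\times p}$ be a sample covariance matrix (symmetric, positive semidefinite), $\alpha\ge 0$, $\beta>0$, $0<c_1\le c_2$, and $K=S+\alpha(2I-\mathbf 1\mathbf 1^T)$. For $w=(w_{ij})_{p\ge i>j\ge1}\in\mathbb{R}^{p(p-1)/2}$ let $\mathcal{L}w\in\mathbb{R}^{p\times p}$ be the symmetric matrix with $[\mathcal{L}w]_{ij}=-w_{ij}$ for $i>j$ and zero row sums, and let $\mathcal{L}^*$ be the adjoint of $\mathcal{L}$, $[\mathcal{L}^*Y]_{ij}=Y_{ii}-Y_{ij}-Y_{ji}+Y_{jj}$. Let $\mathcal{S}_\lambda=\{\lambda\in\mathbb{R}^q: c_1\le\lambda_1\le\dots\le\lambda_q\le c_2\}$, and let $\mathrm{gdet}$ denote the product of the nonzero eigenvalues of a symmetric matrix. Consider the nonconvex problem, over $w\in\mathbb{R}^{p(p-1)/2}$, $U\in\mathbb{R}^{p\times q}$, $\lambda\in\mathbb{R}^q$, $$\min_{w,U,\lambda}\; -\log\mathrm{gdet}\big(U\,\mathrm{Diag}(\lambda)U^T\big)+\mathrm{tr}(K\mathcal{L}w)+\frac{\beta}{2}\big\|\mathcal{L}w-U\,\mathrm{Diag}(\lambda)U^T\big\|_F^2\quad\text{s.t.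 } w\ge 0,\ \lambda\in\mathcal{S}_\lambda,\ U^TU=I_q. \qquad (\ast)$$ A KKT point of $(\ast)$ is a feasible point $(w,U,\lambda)$ for which there are multipliers, nonnegative and satisfying complementary slackness for the inequality constraints $-w_{ij}\le0$, $c_1-\lambda_1\le0$, $\lambda_i-\lambda_{i+1}\le0$, $\lambda_q-c_2\le0$ and of arbitrary sign for the equality constraints $(U^TU-I)_{ij}=0$, such that the Lagrangian is differentiable with zero derivative there. Let $(w^t,U^t,\lambda^t)_{t\ge0}$ be generated, from an arbitrary starting point, by the SGL algorithm, that is, for all $t\ge 0$: 1. $w^{t+1}=\big(w^t-\frac{1}{2p}\nabla f_t(w^t)\big)^+$ entrywise, where $\nabla f_t(w)=\mathcal{L}^*(\mathcal{L}w)-\mathcal{L}^*\big(U^t\mathrm{Diag}(\lambda^t)(U^t)^T-\beta^{-1}K\big)$; 2. the columns of $U^{t+1}$ are the last $q$ vectors of an orthonormal basis of eigenvectors of $\mathcal{L}w^{t+1}$ listed in increasing order of eigenvalues (any such basis may be chosen); 3. $\lambda^{t+1}$ minimizes $-\sum_{i=1}^q\log\lambda_i+\frac{\beta}{2}\|\lambda-d\|_2^2$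 over $\lambda\in\mathcal{S}_\lambda$, where $d_i=\big((U^{t+1})^T(\mathcal{L}w^{t+1})U^{t+1}\big)_{ii}$. Then $(w^t,U^t,\lambda^t)$ converges to the set of KKT points of $(\ast)$: this set is nonempty, the distance of $(w^t,U^t,\lambda^t)$ to it tends to $0$ as $t\to\infty$, and every limit point of the sequence is a KKT point of $(\ast)$. -/

import Mathlib

open Filter Topology

/- Matrices carry the entrywise sup norm here. It is used only for convergence, distances and
differentiability in a finite-dimensional space, where all norms are equivalent; the Frobenius
norm of the objective is written out explicitly below. -/
attribute [local instance] Matrix.normedAddCommGroup Matrix.normedSpace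

namespace SGL

noncomputable section

/-! ### The graph Laplacian operator -/

/-- The pairs `(i, j)` of vertices with `i > j`; they index the `p (p - 1) / 2` coordinates of
a weight vector. -/
abbrev Edge (p : ℕ) : Type := {e : Fin p × Fin p // e.2 < e.1}

/-- The number of coordinates of a weight vector. -/
theorem card_edge (p : ℕ) : Fintype.card (Edge p) = p * (p - 1) / 2 := by
  have h : Fintype.card (Edge p) = ∑ i : Fin p, (i : ℕ) := by
    rw [Fintype.card_subtype, Finset.card_eq_sum_card_fiberwise
      (f := Prod.fst) (t := (Finset.univ : Finset (Fin p))) (fun _ _ => Finset.mem_univ _)]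
    refine Finset.sum_congr rfl fun i _ => ?_
    rw [← Fin.card_Iio i]
    refine Finset.card_bij (fun e _ => e.2) ?_ ?_ ?_
    · intro e he
      simp only [Finset.mem_filter, Finset.mem_univ, true_and] at he
      simp only [Finset.mem_Iio]
      exact he.2 ▸ he.1
    · intro e he e' he' h
      simp only [Finset.mem_filter, Finset.mem_univ, true_and] at he he'
      exact Prod.ext (he.2.trans he'.2.symm) h
    · intro j hj
      exact ⟨(i, j), by simpa using hj, rfl⟩
  rw [h, Fin.sum_univ_eq_sum_range (fun i => i) p, Finset.sum_range_id]

/-- The weight that `w` gives to the unordered pair `{i, j}`, and `0` if `i = j`. -/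
def weight {p : ℕ} (w : Edge p → ℝ) (i j : Fin p) : ℝ :=
  if h : j < i then w ⟨(i, j), h⟩ else if h : i < j then w ⟨(j, i), h⟩ else 0

/-- The graph Laplacian operator `𝓛`: off-diagonal entries are minus the weights, and the
diagonal makes the row sums vanish. -/
def lap {p : ℕ} (w : Edge p → ℝ) : Matrix (Fin p) (Fin p) ℝ :=
  Matrix.of fun i j => if i = j then ∑ m, weight w i m else -weight w i j

/-- The operator `𝓛*`, adjoint to `𝓛` (see `sum_lap_mul`). -/
def lapAdj {p : ℕ} (Y : Matrix (Fin p) (Fin p) ℝ) : Edge p → ℝ :=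
  fun e => Y e.1.1 e.1.1 - Y e.1.1 e.1.2 - Y e.1.2 e.1.1 + Y e.1.2 e.1.2

theorem weight_symm {p : ℕ} (w : Edge p → ℝ) (i j : Fin p) : weight w i j = weight w j i := by
  unfold weight
  rcases lt_trichotomy i j with h | h | h
  · simp [h, h.not_gt]
  · subst h; rfl
  · simp [h, h.not_gt]

theorem weight_self {p : ℕ} (w : Edge p → ℝ) (i : Fin p) : weight w i i = 0 := by
  simp [weight]

theorem lap_row_sum {p : ℕ} (w : Edge p → ℝ) (i : Fin p) : ∑ j, lap w i j = 0 := by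
  have h : ∀ j, lap w i j = (if i = j then ∑ m, weight w i m else 0) - weight w i j := by
    intro j
    by_cases hij : i = j
    · subst hij; simp [lap, weight_self]
    · simp [lap, hij]
  simp [h]

/-- `⟨𝓛 w, Y⟩ = ⟨w, 𝓛* Y⟩`. -/
theorem sum_lap_mul {p : ℕ} (w : Edge p → ℝ) (Y : Matrix (Fin p) (Fin p) ℝ) :
    ∑ i, ∑ j, lap w i j * Y i j = ∑ e, w e * lapAdj Y e := by
  have h : ∀ i, ∑ j, lap w i j * Y i j = ∑ j, weight w i j * (Y i i - Y i j) := by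
    intro i
    have h1 : ∀ j, lap w i j * Y i j =
        (if i = j then (∑ m, weight w i m) * Y i i else 0) - weight w i j * Y i j := by
      intro j
      by_cases hij : i = j
      · subst hij; simp [lap, weight_self]
      · simp [lap, hij]
    simp [h1, mul_sub, Finset.sum_sub_distrib, Finset.sum_mul]
  have hs : ∀ F : Fin p → Fin p → ℝ, (∀ i, F i i = 0) → ∑ i, ∑ j, F i j =
      ∑ e : Edge p, (F e.1.1 e.1.2 + F e.1.2 e.1.1) := by
    intro F hF
    have hF' : ∀ i j, F i j = (if j < i then F i j else 0) + (if i < j then F i j else 0) := by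
      intro i j
      rcases lt_trichotomy i j with h | h | h
      · simp [h, h.not_gt]
      · subst h; simp [hF]
      · simp [h, h.not_gt]
    have e1 : ∑ i, ∑ j, (if i < j then F i j else 0) = ∑ i, ∑ j, (if j < i then F j i else 0) :=
      Finset.sum_comm
    calc ∑ i, ∑ j, F i j
        = ∑ i, ∑ j, (if j < i then F i j else 0) + ∑ i, ∑ j, (if i < j then F i j else 0) := by
          simp_rw [← Finset.sum_add_distrib, ← hF']
      _ = ∑ x : Fin p × Fin p, (if x.2 < x.1 then F x.1 x.2 + F x.2 x.1 else 0) := by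
          rw [e1, ← Finset.sum_add_distrib, Fintype.sum_prod_type]
          refine Finset.sum_congr rfl fun i _ => ?_
          rw [← Finset.sum_add_distrib]
          refine Finset.sum_congr rfl fun j _ => ?_
          split_ifs <;> simp
      _ = _ := by
          rw [← Finset.sum_filter]
          exact Finset.sum_subtype _ (by simp) _
  rw [Finset.sum_congr rfl fun i _ => h i, hs _ (fun i => by simp)]
  refine Finset.sum_congr rfl fun e _ => ?_
  rw [weight_symm w e.1.2 e.1.1]
  have : weight w e.1.1 e.1.2 = w e := by simp [weight, e.2]
  rw [this, lapAdj]
  ring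

/-! ### The optimization problem -/

/-- The triples `(w, U, λ)`. -/
abbrev State (p q : ℕ) : Type :=
  (Edge p → ℝ) × Matrix (Fin p) (Fin q) ℝ × (Fin q → ℝ)

/-- The matrix `U Diag(λ) Uᵀ`. -/
def spec {p q : ℕ} (U : Matrix (Fin p) (Fin q) ℝ) (lam : Fin q → ℝ) : Matrix (Fin p) (Fin p) ℝ :=
  U * Matrix.diagonal lam * U.transpose

theorem spec_isHermitian {p q : ℕ} (U : Matrix (Fin p) (Fin q) ℝ) (lam : Fin q → ℝ) :
    (spec U lam).IsHermitian := by
  simp [Matrix.IsHermitian, spec, Matrix.conjTranspose_eq_transpose_of_trivial,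
    Matrix.transpose_mul, Matrix.mul_assoc]

/-- The generalized determinant: the product of the nonzero eigenvalues (with multiplicity). -/
def gdet {p : ℕ} {A : Matrix (Fin p) (Fin p) ℝ} (hA : A.IsHermitian) : ℝ :=
  ∏ i, if hA.eigenvalues i = 0 then 1 else hA.eigenvalues i

/-- The squared Frobenius norm. -/
def frobSq {p : ℕ} (A : Matrix (Fin p) (Fin p) ℝ) : ℝ := ∑ i, ∑ j, A i j ^ 2

/-- `K = S + α (2 I - 1 1ᵀ)`. -/
def costMat {p : ℕ} (S : Matrix (Fin p) (Fin p) ℝ) (α : ℝ) : Matrix (Fin p) (Fin p) ℝ :=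
  S + α • ((2 : ℝ) • (1 : Matrix (Fin p) (Fin p) ℝ) - Matrix.of fun _ _ => (1 : ℝ))

/-- The objective
`- log gdet (U Diag(λ) Uᵀ) + tr (K 𝓛w) + (β / 2) ‖𝓛w - U Diag(λ) Uᵀ‖_F²`. -/
def objective {p q : ℕ} (K : Matrix (Fin p) (Fin p) ℝ) (β : ℝ) (x : State p q) : ℝ :=
  -Real.log (gdet (spec_isHermitian x.2.1 x.2.2)) + (K * lap x.1).trace
    + β / 2 * frobSq (lap x.1 - spec x.2.1 x.2.2)

/-- The list `c₁, λ₁, …, λ_q, c₂`. -/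
def chain {q : ℕ} (c₁ c₂ : ℝ) (lam : Fin q → ℝ) : Fin (q + 2) → ℝ :=
  Fin.cons (α := fun _ => ℝ) c₁ (Fin.snoc (α := fun _ => ℝ) lam c₂)

/-- The set `S_λ`, given by the `q + 1` inequalities `c₁ ≤ λ₁ ≤ ⋯ ≤ λ_q ≤ c₂`. -/
def Slam {q : ℕ} (c₁ c₂ : ℝ) : Set (Fin q → ℝ) :=
  {lam | ∀ i : Fin (q + 1), chain c₁ c₂ lam i.castSucc ≤ chain c₁ c₂ lam i.succ}

theorem mem_Slam_iff {q : ℕ} {c₁ c₂ : ℝ} (hc : c₁ ≤ c₂) {lam : Fin q → ℝ} :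
    lam ∈ Slam c₁ c₂ ↔ Monotone lam ∧ ∀ i, c₁ ≤ lam i ∧ lam i ≤ c₂ := by
  have hmid : ∀ i : Fin q, chain c₁ c₂ lam i.castSucc.succ = lam i := by
    intro i; simp [chain]
  have h0 : chain c₁ c₂ lam 0 = c₁ := rfl
  have hl : chain c₁ c₂ lam (Fin.last (q + 1)) = c₂ := by
    rw [← Fin.succ_last]; simp [chain]
  rw [Slam, Set.mem_ofPred_eq, ← Fin.monotone_iff_le_succ (f := chain c₁ c₂ lam)]
  constructor
  · intro h
    refine ⟨fun i j hij => ?_, fun i => ⟨?_, ?_⟩⟩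
    · rw [← hmid i, ← hmid j]
      exact h (by simpa using hij)
    · rw [← hmid i, ← h0]; exact h (Fin.zero_le _)
    · have h1 := h (Fin.le_last i.castSucc.succ)
      rwa [hmid, hl] at h1
  · rintro ⟨hm, hb⟩ i j hij
    induction i using Fin.cases with
    | zero =>
      rw [h0]
      induction j using Fin.cases with
      | zero => exact h0.ge
      | succ j =>
        induction j using Fin.lastCases with
        | last => rw [Fin.succ_last, hl]; exact hc
        | cast j => rw [hmid]; exact (hb j).1
    | succ i =>
      induction j using Fin.cases with
      | zero => simp at hij
      | succ j =>
        induction j using Fin.lastCases with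
        | last =>
          rw [Fin.succ_last, hl]
          induction i using Fin.lastCases with
          | last => rw [Fin.succ_last, hl]
          | cast i => rw [hmid]; exact (hb i).2
        | cast j =>
          induction i using Fin.lastCases with
          | last =>
            exfalso
            have := j.2
            simp [Fin.le_def] at hij
            omega
          | cast i => rw [hmid, hmid]; exact hm (by simpa using hij)

/-- `x` is a KKT point of the problem: minimize `f` subject to `g i ≤ 0` for all `i` and
`h j = 0` for all `j`. That is, `x` is feasible, and there are multipliers `μ ≥ 0` and `ν` with
complementary slackness for which the Lagrangian is stationary at `x`. -/
def IsKKTPoint {E ι κ : Type*} [NormedAddCommGroup E] [NormedSpace ℝ E] [Fintype ι] [Fintype κ]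
    (f : E → ℝ) (g : ι → E → ℝ) (h : κ → E → ℝ) (x : E) : Prop :=
  (∀ i, g i x ≤ 0) ∧ (∀ j, h j x = 0) ∧
    ∃ (μ : ι → ℝ) (ν : κ → ℝ), (∀ i, 0 ≤ μ i) ∧ (∀ i, μ i * g i x = 0) ∧
      HasFDerivAt (fun z => f z + ∑ i, μ i * g i z + ∑ j, ν j * h j z) (0 : E →L[ℝ] ℝ) x

/-- The inequality constraints `-w_e ≤ 0`, and `c₁ - λ₁ ≤ 0`, `λ_i - λ_{i+1} ≤ 0`,
`λ_q - c₂ ≤ 0`. -/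
def ineqConstraint {p q : ℕ} (c₁ c₂ : ℝ) : Edge p ⊕ Fin (q + 1) → State p q → ℝ
  | Sum.inl e, x => -x.1 e
  | Sum.inr i, x => chain c₁ c₂ x.2.2 i.castSucc - chain c₁ c₂ x.2.2 i.succ

/-- The equality constraints `(Uᵀ U - I)_{ij} = 0`. -/
def eqConstraint {p q : ℕ} : Fin q × Fin q → State p q → ℝ :=
  fun ij x => (x.2.1.transpose * x.2.1 - 1 : Matrix (Fin q) (Fin q) ℝ) ij.1 ij.2

/-- The set of KKT points of the problem: minimize the objective subject to `w ≥ 0`, `λ ∈ S_λ`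
and `Uᵀ U = I`. -/
def kktSet {p q : ℕ} (K : Matrix (Fin p) (Fin p) ℝ) (β c₁ c₂ : ℝ) : Set (State p q) :=
  {x | IsKKTPoint (objective K β) (ineqConstraint c₁ c₂) eqConstraint x}

/-! ### The algorithm -/

/-- `∇f(w) = 𝓛*(𝓛w) - c`, where `c = 𝓛*(U Diag(λ) Uᵀ - β⁻¹ K)`. -/
def gradF {p q : ℕ} (K : Matrix (Fin p) (Fin p) ℝ) (β : ℝ) (w : Edge p → ℝ)
    (U : Matrix (Fin p) (Fin q) ℝ) (lam : Fin q → ℝ) : Edge p → ℝ :=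
  lapAdj (lap w) - lapAdj (spec U lam - β⁻¹ • K)

/-- The update `(w - (1 / 2p) ∇f(w))⁺`. -/
def wUpdate {p q : ℕ} (K : Matrix (Fin p) (Fin p) ℝ) (β : ℝ) (w : Edge p → ℝ)
    (U : Matrix (Fin p) (Fin q) ℝ) (lam : Fin q → ℝ) : Edge p → ℝ :=
  fun e => max (w e - 1 / (2 * (p : ℝ)) * gradF K β w U lam e) 0

/-- `U = eigenvectors(A)[k+1 : p]`, where `p = k + q`: the columns of `U` are the last `q` vectors
of some orthonormal basis of eigenvectors of `A` (the columns of `V`), listed in increasing order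
of the eigenvalues `ev`. -/
def IsTopEigenvectors {k q : ℕ} (A : Matrix (Fin (k + q)) (Fin (k + q)) ℝ)
    (U : Matrix (Fin (k + q)) (Fin q) ℝ) : Prop :=
  ∃ (V : Matrix (Fin (k + q)) (Fin (k + q)) ℝ) (ev : Fin (k + q) → ℝ),
    V.transpose * V = 1 ∧ Monotone ev ∧ A * V = V * Matrix.diagonal ev ∧
      ∀ i j, U i j = V i (Fin.natAdd k j)

/-- The function `-∑ log λ_i + (β / 2) ‖λ - d‖²` with `d_i = (Uᵀ 𝓛w U)_{ii}`. -/
def lamObjective {p q : ℕ} (β : ℝ) (w : Edge p → ℝ) (U : Matrix (Fin p) (Fin q) ℝ)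
    (lam : Fin q → ℝ) : ℝ :=
  -∑ i, Real.log (lam i) + β / 2 * ∑ i, (lam i - (U.transpose * lap w * U) i i) ^ 2

/-- `(w t, U t, lam t)` is a sequence of iterates of the SGL algorithm (started anywhere). -/
structure IsSGLSequence {k q : ℕ} (K : Matrix (Fin (k + q)) (Fin (k + q)) ℝ) (β c₁ c₂ : ℝ)
    (w : ℕ → Edge (k + q) → ℝ) (U : ℕ → Matrix (Fin (k + q)) (Fin q) ℝ)
    (lam : ℕ → Fin q → ℝ) : Prop where
  w_step : ∀ t, w (t + 1) = wUpdate K β (w t) (U t) (lam t)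
  U_step : ∀ t, IsTopEigenvectors (lap (w (t + 1))) (U (t + 1))
  lam_mem : ∀ t, lam (t + 1) ∈ Slam c₁ c₂
  lam_min : ∀ t, IsMinOn (lamObjective β (w (t + 1)) (U (t + 1))) (Slam c₁ c₂) (lam (t + 1))

end

end SGL

namespace SGL

/-! ### The Laplacian operator and its adjoint -/

/-! The algorithm is a block descent method. On `Uᵀ U = I` the objective equals `merit`, where `∑
log λ_i` replaces the log of the generalized determinant, and no block update increases `merit`. The
weight step is a projected gradient step whose length `1 / (2p)` matches `‖𝓛‖² ≤ 2p`; it lowers the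
merit by at least `β p ‖Δw‖²` (`merit_wUpdate_le`). The eigenvector step maximizes `∑ λ_j (Uᵀ 𝓛w
U)_jj` over orthonormal frames, by Ky Fan's inequality weighted with the increasing `λ`
(`IsTopEigenvectors.sum_mul_le`). The eigenvalue step minimizes `merit` in `λ`, up to terms free of
`λ` (`merit_eq_lamObjective`).

Since `𝓛*K ≥ 0`, `w ≥ 0` and `λ ≤ c₂`, the merit is bounded below and controls `w` (`le_merit`,
`abs_weight_le`). So the iterates stay bounded and `w (t + 1) - w t → 0`. The other optimality
conditions relate `w`, `U`, `lam` at one index and are closed, so they pass to limit points without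
any convergence of `U` or `lam` (`IsSGLSequence.mem_kktSet_of_tendsto`).

A triple satisfying these limiting conditions is a KKT point (`mem_kktSet_of_stationary`). Off the
constraint `Uᵀ U = I` the generalized determinant is `det (Uᵀ U) ∏ λ_i` (`gdet_spec`); the extra
factor only adds `1` to the diagonal multipliers of `Uᵀ U = I`. Compactness then turns the statement
about limit points into convergence of the distance. -/

theorem weight_edge {p : ℕ} (w : Edge p → ℝ) (e : Edge p) : weight w e.1.1 e.1.2 = w e := by
  simp [weight, e.2]

theorem weight_add {p : ℕ} (w v : Edge p → ℝ) (i j : Fin p) :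
    weight (w + v) i j = weight w i j + weight v i j := by
  unfold weight
  split_ifs <;> simp

theorem weight_smul {p : ℕ} (t : ℝ) (w : Edge p → ℝ) (i j : Fin p) :
    weight (t • w) i j = t * weight w i j := by
  unfold weight
  split_ifs <;> simp

theorem lap_add {p : ℕ} (w v : Edge p → ℝ) : lap (w + v) = lap w + lap v := by
  ext i j
  by_cases h : i = j
  · simp [lap, h, weight_add, Finset.sum_add_distrib]
  · simp [lap, h, weight_add]; ring

theorem lap_smul {p : ℕ} (t : ℝ) (w : Edge p → ℝ) : lap (t • w) = t • lap w := by
  ext i j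
  by_cases h : i = j
  · simp [lap, h, weight_smul, Finset.mul_sum]
  · simp [lap, h, weight_smul]

/-- The Laplacian operator as a linear map. -/
def lapLinear (p : ℕ) : (Edge p → ℝ) →ₗ[ℝ] Matrix (Fin p) (Fin p) ℝ where
  toFun := lap
  map_add' := lap_add
  map_smul' := lap_smul

theorem lap_transpose {p : ℕ} (w : Edge p → ℝ) : (lap w).transpose = lap w := by
  ext i j
  by_cases h : i = j
  · simp [h]
  · simp [lap, h, Ne.symm h, weight_symm w i j]

theorem lap_edge {p : ℕ} (w : Edge p → ℝ) (e : Edge p) : lap w e.1.1 e.1.2 = -w e := by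
  have h : e.1.1 ≠ e.1.2 := e.2.ne'
  simp [lap, h, weight_edge]

/-- The adjoint identity `sum_lap_mul`, tested on the matrix of negated weights, turns the sum over
ordered pairs into a sum over edges. -/
theorem sum_weight_sq {p : ℕ} (w : Edge p → ℝ) :
    ∑ i, ∑ j, weight w i j ^ 2 = 2 * ∑ e, w e ^ 2 := by
  have h := sum_lap_mul w (Matrix.of fun i j => -weight w i j)
  have h1 : ∀ i j, lap w i j * Matrix.of (fun i j => -weight w i j) i j = weight w i j ^ 2 := by
    intro i j
    by_cases hij : i = j
    · subst hij; simp [weight_self]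
    · simp [lap, hij]; ring
  simp_rw [h1] at h
  rw [h, Finset.mul_sum]
  refine Finset.sum_congr rfl fun e _ => ?_
  simp only [lapAdj, Matrix.of_apply, weight_self, weight_symm w e.1.2 e.1.1, weight_edge]
  ring

/-- `‖𝓛‖² ≤ 2 p`. -/
theorem frobSq_lap_le {p : ℕ} (w : Edge p → ℝ) :
    frobSq (lap w) ≤ 2 * p * ∑ e, w e ^ 2 := by
  have row : ∀ i, ∑ j, lap w i j ^ 2 ≤ p * ∑ j, weight w i j ^ 2 := by
    intro i
    have hp : (1 : ℝ) ≤ p := by exact_mod_cast i.pos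
    have h1 : ∀ j, lap w i j ^ 2 =
        (if i = j then (∑ m, weight w i m) ^ 2 else 0) + weight w i j ^ 2 := by
      intro j
      by_cases hij : i = j
      · subst hij; simp [lap, weight_self]
      · simp [lap, hij]
    -- Cauchy–Schwarz over the `p - 1` vertices other than `i`; the off-diagonal squares supply the
    -- missing `1` in the factor `p`.
    have h2 : (∑ m, weight w i m) ^ 2 ≤ (p - 1) * ∑ j, weight w i j ^ 2 := by
      rw [← Finset.add_sum_erase _ _ (Finset.mem_univ i),
        ← Finset.add_sum_erase _ (fun j => weight w i j ^ 2) (Finset.mem_univ i)]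
      simp only [weight_self]
      have h3 := sq_sum_le_card_mul_sum_sq (s := Finset.univ.erase i) (f := fun m => weight w i m)
      rw [Finset.card_erase_of_mem (Finset.mem_univ i), Finset.card_univ, Fintype.card_fin,
        Nat.cast_sub i.pos] at h3
      simpa using h3
    simp_rw [h1, Finset.sum_add_distrib]
    simp only [Finset.sum_ite_eq, Finset.mem_univ, if_true]
    linarith
  calc frobSq (lap w) ≤ ∑ i, p * ∑ j, weight w i j ^ 2 := Finset.sum_le_sum fun i _ => row i
    _ = _ := by rw [← Finset.mul_sum, sum_weight_sq]; ring

theorem trace_mul_lap {p : ℕ} (K : Matrix (Fin p) (Fin p) ℝ) (w : Edge p → ℝ) :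
    (K * lap w).trace = ∑ e, w e * lapAdj K e := by
  have hs : ∀ i j, lap w i j = lap w j i := fun i j => congrFun (congrFun (lap_transpose w) j) i
  rw [← sum_lap_mul]
  simp only [Matrix.trace, Matrix.diag, Matrix.mul_apply]
  refine Finset.sum_congr rfl fun i _ => Finset.sum_congr rfl fun j _ => ?_
  rw [hs, mul_comm]

/-- Each coordinate of `𝓛* Y` is the quadratic form of `Y` at a difference of two basis vectors; the
term `α (2 I - 1 1ᵀ)` contributes `4 α`. This makes the linear term of the objective nonnegative for
`w ≥ 0`. -/
theorem lapAdj_costMat_nonneg {p : ℕ} {S : Matrix (Fin p) (Fin p) ℝ} (hS : S.PosSemidef)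
    {α : ℝ} (hα : 0 ≤ α) (e : Edge p) : 0 ≤ lapAdj (costMat S α) e := by
  have hne : e.1.1 ≠ e.1.2 := e.2.ne'
  have h := hS.dotProduct_mulVec_nonneg (Pi.single e.1.1 1 - Pi.single e.1.2 1)
  have h2 : lapAdj (costMat S α) e = lapAdj S e + 4 * α := by
    simp [lapAdj, costMat, hne, hne.symm]; ring
  have h3 : lapAdj S e = star (Pi.single e.1.1 1 - Pi.single e.1.2 1 : Fin p → ℝ) ⬝ᵥ
      S.mulVec (Pi.single e.1.1 1 - Pi.single e.1.2 1) := by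
    simp [lapAdj, Matrix.mulVec_sub, dotProduct_sub, sub_dotProduct]; ring
  rw [h2, h3]
  positivity

theorem lapAdj_smul {p : ℕ} (t : ℝ) (Y : Matrix (Fin p) (Fin p) ℝ) :
    lapAdj (t • Y) = t • lapAdj Y := by
  ext e; simp [lapAdj]; ring

theorem lapAdj_sub {p : ℕ} (Y Z : Matrix (Fin p) (Fin p) ℝ) :
    lapAdj (Y - Z) = lapAdj Y - lapAdj Z := by
  ext e; simp [lapAdj]; ring

theorem gradF_apply {p q : ℕ} (K : Matrix (Fin p) (Fin p) ℝ) (β : ℝ) (w : Edge p → ℝ)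
    (U : Matrix (Fin p) (Fin q) ℝ) (lam : Fin q → ℝ) (e : Edge p) :
    gradF K β w U lam e = lapAdj (lap w - spec U lam) e + β⁻¹ * lapAdj K e := by
  simp [gradF, lapAdj_sub, lapAdj_smul]; ring

/-! ### The merit function and the weight update -/

/-- The objective with `log gdet (U Diag(λ) Uᵀ)` replaced by `∑ log λ_i`; the two agree when
`Uᵀ U = I`. -/
noncomputable def merit {p q : ℕ} (K : Matrix (Fin p) (Fin p) ℝ) (β : ℝ) (w : Edge p → ℝ)
    (U : Matrix (Fin p) (Fin q) ℝ) (lam : Fin q → ℝ) : ℝ :=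
  -∑ i, Real.log (lam i) + ∑ e, w e * lapAdj K e + β / 2 * frobSq (lap w - spec U lam)

theorem frobSq_add {p : ℕ} (A B : Matrix (Fin p) (Fin p) ℝ) :
    frobSq (A + B) = frobSq A + 2 * ∑ i, ∑ j, B i j * A i j + frobSq B := by
  simp only [frobSq, Matrix.add_apply, Finset.mul_sum, ← Finset.sum_add_distrib]
  refine Finset.sum_congr rfl fun i _ => Finset.sum_congr rfl fun j _ => ?_
  ring

/-- The merit is a quadratic polynomial in `w` with gradient `β • gradF`, so the expansion is exact.
-/
theorem merit_add {p q : ℕ} (K : Matrix (Fin p) (Fin p) ℝ) {β : ℝ} (hβ : β ≠ 0)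
    (w δ : Edge p → ℝ) (U : Matrix (Fin p) (Fin q) ℝ) (lam : Fin q → ℝ) :
    merit K β (w + δ) U lam = merit K β w U lam + β * ∑ e, δ e * gradF K β w U lam e
      + β / 2 * frobSq (lap δ) := by
  have h : lap (w + δ) - spec U lam = (lap w - spec U lam) + lap δ := by rw [lap_add]; abel
  have h2 : β * ∑ e, δ e * gradF K β w U lam e =
      β * ∑ e, δ e * lapAdj (lap w - spec U lam) e + ∑ e, δ e * lapAdj K e := by
    simp_rw [gradF_apply, mul_add, Finset.sum_add_distrib, mul_add, Finset.mul_sum]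
    congr 1
    refine Finset.sum_congr rfl fun e _ => ?_
    field_simp
  rw [h2, merit, merit, h, frobSq_add, sum_lap_mul]
  simp only [Pi.add_apply, add_mul, Finset.sum_add_distrib]
  ring

theorem merit_wUpdate_le {p q : ℕ} (K : Matrix (Fin p) (Fin p) ℝ) {β : ℝ} (hβ : 0 < β)
    (hp : 0 < p) {w : Edge p → ℝ} (hw : 0 ≤ w) (U : Matrix (Fin p) (Fin q) ℝ)
    (lam : Fin q → ℝ) :
    merit K β (wUpdate K β w U lam) U lam + β * p * ∑ e, (wUpdate K β w U lam e - w e) ^ 2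
      ≤ merit K β w U lam := by
  obtain ⟨δ, hδ⟩ : ∃ δ, δ = wUpdate K β w U lam - w := ⟨_, rfl⟩
  have hw' : wUpdate K β w U lam = w + δ := by rw [hδ]; abel
  have hp' : (0 : ℝ) < p := by exact_mod_cast hp
  -- Without clipping `δ = -g / (2p)` and equality holds; with clipping `δ = -w` and `2 p w ≤ g`.
  -- The quadratic term of `merit_add` then takes back at most half of this gain.
  have step : ∀ e, δ e * gradF K β w U lam e ≤ -(2 * p * δ e ^ 2) := by
    intro e
    have h0 : 0 ≤ w e := hw e
    rw [hδ]
    simp only [Pi.sub_apply, wUpdate]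
    set g := gradF K β w U lam e
    rcases le_total 0 (w e - 1 / (2 * (p : ℝ)) * g) with h | h
    · rw [max_eq_left h]
      refine le_of_eq ?_
      field_simp
      ring
    · rw [max_eq_right h]
      have h1 : 2 * p * w e ≤ g := by
        have h2 : w e ≤ g / (2 * p) := by
          have : 1 / (2 * (p : ℝ)) * g = g / (2 * p) := by ring
          linarith
        rw [le_div_iff₀ (by positivity)] at h2
        linarith
      nlinarith [mul_le_mul_of_nonneg_left h1 h0]
  have hsum : ∑ e, δ e * gradF K β w U lam e ≤ -(2 * p * ∑ e, δ e ^ 2) := by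
    rw [Finset.mul_sum, ← Finset.sum_neg_distrib]
    exact Finset.sum_le_sum fun e _ => step e
  have h1 := merit_add K hβ.ne' w δ U lam
  have h2 := mul_le_mul_of_nonneg_left hsum hβ.le
  have h3 := mul_le_mul_of_nonneg_left (frobSq_lap_le δ) (half_pos hβ).le
  rw [hw', h1]
  simp only [Pi.add_apply, add_sub_cancel_left]
  nlinarith

/-! ### The eigenvector update -/

theorem sum_sum_mul_eq_trace {m n : ℕ} (A B : Matrix (Fin m) (Fin n) ℝ) :
    ∑ i, ∑ j, A i j * B i j = (A.transpose * B).trace := by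
  simp only [Matrix.trace, Matrix.diag, Matrix.mul_apply, Matrix.transpose_apply]
  exact Finset.sum_comm

theorem sum_sum_mul_spec {p q : ℕ} (A : Matrix (Fin p) (Fin p) ℝ)
    (U : Matrix (Fin p) (Fin q) ℝ) (lam : Fin q → ℝ) :
    ∑ i, ∑ j, spec U lam i j * A i j = ∑ j, lam j * (U.transpose * A * U) j j := by
  have hs : (spec U lam).transpose = spec U lam := by
    simpa [Matrix.IsHermitian, Matrix.conjTranspose_eq_transpose_of_trivial]
      using spec_isHermitian U lam
  rw [sum_sum_mul_eq_trace, hs, spec, Matrix.mul_assoc, Matrix.trace_mul_comm,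
    ← Matrix.mul_assoc, Matrix.trace_mul_comm]
  simp [Matrix.trace]

theorem frobSq_spec {p q : ℕ} {U : Matrix (Fin p) (Fin q) ℝ} (hU : U.transpose * U = 1)
    (lam : Fin q → ℝ) : frobSq (spec U lam) = ∑ j, lam j ^ 2 := by
  have h := sum_sum_mul_spec (spec U lam) U lam
  have h2 : U.transpose * spec U lam * U = Matrix.diagonal lam := by
    rw [spec, ← Matrix.mul_assoc, ← Matrix.mul_assoc, hU, Matrix.one_mul, Matrix.mul_assoc, hU,
      Matrix.mul_one]
  rw [h2] at h
  simpa [frobSq, pow_two] using h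

/-- For orthonormal `U` the norm of `U Diag(λ) Uᵀ` does not depend on `U`, so `U` enters only
through the Rayleigh quotients. -/
theorem merit_eq {p q : ℕ} (K : Matrix (Fin p) (Fin p) ℝ) (β : ℝ) (w : Edge p → ℝ)
    {U : Matrix (Fin p) (Fin q) ℝ} (hU : U.transpose * U = 1) (lam : Fin q → ℝ) :
    merit K β w U lam = -∑ i, Real.log (lam i) + ∑ e, w e * lapAdj K e
      + β / 2 * (frobSq (lap w) - 2 * ∑ j, lam j * (U.transpose * lap w * U) j j
        + ∑ j, lam j ^ 2) := by
  rw [merit, sub_eq_add_neg, frobSq_add]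
  have h3 : frobSq (-spec U lam) = frobSq (spec U lam) := by simp [frobSq]
  have h4 := sum_sum_mul_spec (lap w) U lam
  rw [h3, frobSq_spec hU]
  simp only [Matrix.neg_apply, neg_mul, Finset.sum_neg_distrib, h4]
  ring

/-- Abel summation: a nonnegative increasing `a` is a nonnegative combination of tail indicators.
The induction splits off `a 0` times the full sum. -/
theorem sum_mul_nonneg_of_tail_sum_nonneg {q : ℕ} {a x : Fin q → ℝ} (ha : Monotone a)
    (h0 : ∀ i, 0 ≤ a i) (hx : ∀ m, 0 ≤ ∑ j, if m ≤ j then x j else 0) :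
    0 ≤ ∑ j, a j * x j := by
  induction q with
  | zero => simp
  | succ q ih =>
    have h1 : ∑ j, a j * x j = a 0 * ∑ j, x j + ∑ j : Fin q, (a j.succ - a 0) * x j.succ := by
      rw [Fin.sum_univ_succ, Fin.sum_univ_succ]
      simp only [sub_mul, Finset.sum_sub_distrib, mul_add, Finset.mul_sum]
      ring
    rw [h1]
    refine add_nonneg (mul_nonneg (h0 0) (by simpa using hx 0)) (ih ?_ ?_ ?_)
    · intro i j hij
      have := ha (Fin.succ_le_succ_iff.2 hij)
      simpa using this
    · intro i
      have := ha (Fin.zero_le i.succ)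
      simpa using this
    · intro m
      have := hx m.succ
      rw [Fin.sum_univ_succ] at this
      simpa using this

/-- The matrix `P = B Bᵀ` is a symmetric projection, so `P i i = ∑ l, P i l ^ 2 ≥ P i i ^ 2`. -/
theorem sum_sq_row_le_one {m n : ℕ} {B : Matrix (Fin m) (Fin n) ℝ} (hB : B.transpose * B = 1)
    (i : Fin m) : ∑ j, B i j ^ 2 ≤ 1 := by
  set P := B * B.transpose with hP
  have hPP : P * P = P := by
    rw [hP, Matrix.mul_assoc, ← Matrix.mul_assoc B.transpose, hB, Matrix.one_mul]
  have hPi : P i i = ∑ j, B i j ^ 2 := by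
    simp [hP, Matrix.mul_apply, pow_two]
  have hsym : ∀ l, P l i = P i l := by
    intro l; simp [hP, Matrix.mul_apply, mul_comm]
  have h1 : P i i = ∑ l, P i l ^ 2 := by
    conv_lhs => rw [← hPP, Matrix.mul_apply]
    exact Finset.sum_congr rfl fun l _ => by rw [hsym, pow_two]
  have h2 : P i i ^ 2 ≤ ∑ l, P i l ^ 2 :=
    Finset.single_le_sum (f := fun l => P i l ^ 2) (fun l _ => sq_nonneg _) (Finset.mem_univ i)
  rw [← hPi]
  nlinarith

/-- Ky Fan's inequality, for the trailing columns of `B`. -/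
theorem tail_sum_nonneg {k q : ℕ} {ev : Fin (k + q) → ℝ} (hev : Monotone ev)
    {B : Matrix (Fin (k + q)) (Fin q) ℝ} (hB : B.transpose * B = 1) (m : Fin q) :
    0 ≤ ∑ j, if m ≤ j then ev (Fin.natAdd k j) - ∑ i, ev i * B i j ^ 2 else 0 := by
  -- Shifting by the smallest eigenvalue of the tail is harmless because the columns of `B` have
  -- norm one. After the shift the tail eigenvalues are their own positive parts and all earlier
  -- positive parts vanish, while each row of `B` gives its eigenvalue a weight in `[0, 1]`.
  set c := ev (Fin.natAdd k m) with hc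
  have hcol : ∀ j, ∑ i, B i j ^ 2 = 1 := by
    intro j
    have := congrFun (congrFun hB j) j
    simpa [Matrix.mul_apply, pow_two] using this
  have h1 : ∀ j, (if m ≤ j then ev (Fin.natAdd k j) - ∑ i, ev i * B i j ^ 2 else 0) =
      max (ev (Fin.natAdd k j) - c) 0 -
        ∑ i, (ev i - c) * (if m ≤ j then B i j ^ 2 else 0) := by
    intro j
    by_cases hj : m ≤ j
    · have : c ≤ ev (Fin.natAdd k j) := hev (by simpa only [Fin.natAdd_le_natAdd_iff] using hj)
      rw [max_eq_left (by linarith)]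
      simp only [hj, if_true, sub_mul, Finset.sum_sub_distrib, ← Finset.mul_sum, hcol]
      ring
    · have : ev (Fin.natAdd k j) ≤ c :=
        hev (by simpa only [Fin.natAdd_le_natAdd_iff] using (not_le.1 hj).le)
      rw [max_eq_right (by linarith)]
      simp [hj]
  have h2 : ∑ i, max (ev i - c) 0 = ∑ j : Fin q, max (ev (Fin.natAdd k j) - c) 0 := by
    rw [Fin.sum_univ_add]
    have : ∀ i : Fin k, max (ev (Fin.castAdd q i) - c) 0 = 0 := by
      intro i
      refine max_eq_right (sub_nonpos.2 (hev ?_))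
      simp [Fin.le_def]; omega
    simp [this]
  have h3 : ∀ i, (ev i - c) * ∑ j, (if m ≤ j then B i j ^ 2 else 0) ≤ max (ev i - c) 0 := by
    intro i
    have hr0 : 0 ≤ ∑ j, (if m ≤ j then B i j ^ 2 else 0) :=
      Finset.sum_nonneg fun j _ => by split_ifs <;> positivity
    have hr1 : ∑ j, (if m ≤ j then B i j ^ 2 else 0) ≤ 1 :=
      (Finset.sum_le_sum fun j _ => by
        split_ifs
        exacts [le_rfl, sq_nonneg _]).trans (sum_sq_row_le_one hB i)
    calc _ ≤ max (ev i - c) 0 * ∑ j, (if m ≤ j then B i j ^ 2 else 0) :=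
          mul_le_mul_of_nonneg_right (le_max_left _ _) hr0
      _ ≤ max (ev i - c) 0 * 1 := mul_le_mul_of_nonneg_left hr1 (le_max_right _ _)
      _ = _ := mul_one _
  rw [Finset.sum_congr rfl fun j _ => h1 j, Finset.sum_sub_distrib, Finset.sum_comm, ← h2,
    ← Finset.sum_sub_distrib]
  refine Finset.sum_nonneg fun i _ => ?_
  rw [← Finset.mul_sum]
  linarith [h3 i]

theorem IsTopEigenvectors.transpose_mul_self {k q : ℕ}
    {A : Matrix (Fin (k + q)) (Fin (k + q)) ℝ} {U : Matrix (Fin (k + q)) (Fin q) ℝ}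
    (h : IsTopEigenvectors A U) : U.transpose * U = 1 := by
  obtain ⟨V, ev, hV, -, -, hU⟩ := h
  ext i j
  have := congrFun (congrFun hV (Fin.natAdd k i)) (Fin.natAdd k j)
  simp only [Matrix.mul_apply, Matrix.transpose_apply, Matrix.one_apply, Fin.natAdd_inj] at this
  simpa [Matrix.mul_apply, Matrix.one_apply, hU] using this

theorem mul_eq_mul_diagonal_natAdd {k q : ℕ}
    {A V : Matrix (Fin (k + q)) (Fin (k + q)) ℝ} {U : Matrix (Fin (k + q)) (Fin q) ℝ}
    {ev : Fin (k + q) → ℝ} (hA : A * V = V * Matrix.diagonal ev)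
    (hU : ∀ i j, U i j = V i (Fin.natAdd k j)) :
    A * U = U * Matrix.diagonal fun j => ev (Fin.natAdd k j) := by
  ext i j
  have := congrFun (congrFun hA i) (Fin.natAdd k j)
  rw [Matrix.mul_diagonal, Matrix.mul_apply] at this
  rw [Matrix.mul_diagonal, Matrix.mul_apply, hU]
  simpa only [hU] using this

/-- Expressing the eigenvalues as Rayleigh quotients of `U` leaves a closed condition in `(A, U)`,
which survives limits. -/
theorem IsTopEigenvectors.mul_eq {k q : ℕ}
    {A : Matrix (Fin (k + q)) (Fin (k + q)) ℝ} {U : Matrix (Fin (k + q)) (Fin q) ℝ}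
    (h : IsTopEigenvectors A U) :
    A * U = U * Matrix.diagonal fun j => (U.transpose * A * U) j j := by
  have hUU := h.transpose_mul_self
  obtain ⟨V, ev, hV, -, hA, hU⟩ := h
  have h1 := mul_eq_mul_diagonal_natAdd hA hU
  have h2 : U.transpose * A * U = Matrix.diagonal fun j => ev (Fin.natAdd k j) := by
    rw [Matrix.mul_assoc, h1, ← Matrix.mul_assoc, hUU, Matrix.one_mul]
  rw [h2]
  simpa using h1

/-- In the eigenbasis, with `B = Vᵀ W`, Ky Fan's inequality bounds every tail sum; Abel summation
against the increasing `lam` combines these bounds. -/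
theorem IsTopEigenvectors.sum_mul_le {k q : ℕ}
    {A : Matrix (Fin (k + q)) (Fin (k + q)) ℝ} {U W : Matrix (Fin (k + q)) (Fin q) ℝ}
    (h : IsTopEigenvectors A U) (hW : W.transpose * W = 1) {lam : Fin q → ℝ}
    (hm : Monotone lam) (h0 : ∀ i, 0 ≤ lam i) :
    ∑ j, lam j * (W.transpose * A * W) j j ≤ ∑ j, lam j * (U.transpose * A * U) j j := by
  have hUU := h.transpose_mul_self
  obtain ⟨V, ev, hV, hev, hA, hU⟩ := h
  have hVV : V * V.transpose = 1 := mul_eq_one_comm.1 hV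
  have hAV : A = V * Matrix.diagonal ev * V.transpose := by
    rw [← hA, Matrix.mul_assoc, hVV, Matrix.mul_one]
  have h1 := mul_eq_mul_diagonal_natAdd hA hU
  have h2 : U.transpose * A * U = Matrix.diagonal fun j => ev (Fin.natAdd k j) := by
    rw [Matrix.mul_assoc, h1, ← Matrix.mul_assoc, hUU, Matrix.one_mul]
  set B := V.transpose * W with hB
  have hBB : B.transpose * B = 1 := by
    rw [hB, Matrix.transpose_mul, Matrix.transpose_transpose, Matrix.mul_assoc,
      ← Matrix.mul_assoc V, hVV, Matrix.one_mul, hW]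
  have h3 : ∀ j, (W.transpose * A * W) j j = ∑ i, ev i * B i j ^ 2 := by
    intro j
    have : W.transpose * A * W = B.transpose * (Matrix.diagonal ev * B) := by
      rw [hAV, hB, Matrix.transpose_mul, Matrix.transpose_transpose]
      simp only [Matrix.mul_assoc]
    rw [this, Matrix.mul_apply]
    refine Finset.sum_congr rfl fun i _ => ?_
    rw [Matrix.diagonal_mul, Matrix.transpose_apply]
    ring
  have h4 := sum_mul_nonneg_of_tail_sum_nonneg hm h0 (fun m => tail_sum_nonneg hev hBB m)
  simp only [mul_sub, Finset.sum_sub_distrib] at h4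
  rw [h2]
  simp only [h3, Matrix.diagonal_apply_eq]
  linarith

theorem merit_le_of_isTopEigenvectors {k q : ℕ} (K : Matrix (Fin (k + q)) (Fin (k + q)) ℝ)
    {β : ℝ} (hβ : 0 < β) {w : Edge (k + q) → ℝ} {U W : Matrix (Fin (k + q)) (Fin q) ℝ}
    (h : IsTopEigenvectors (lap w) U) (hW : W.transpose * W = 1) {lam : Fin q → ℝ}
    (hm : Monotone lam) (h0 : ∀ i, 0 ≤ lam i) : merit K β w U lam ≤ merit K β w W lam := by
  rw [merit_eq K β w hW, merit_eq K β w h.transpose_mul_self]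
  have := h.sum_mul_le hW hm h0
  gcongr

/-! ### The eigenvalue update -/

/-- Completing the square in `lam`: the bracket does not involve `lam`, so both functions have the
same minimizers in `lam`. -/
theorem merit_eq_lamObjective {p q : ℕ} (K : Matrix (Fin p) (Fin p) ℝ) (β : ℝ)
    (w : Edge p → ℝ) {U : Matrix (Fin p) (Fin q) ℝ} (hU : U.transpose * U = 1)
    (lam : Fin q → ℝ) :
    merit K β w U lam = lamObjective β w U lam + (∑ e, w e * lapAdj K e
      + β / 2 * (frobSq (lap w) - ∑ j, (U.transpose * lap w * U) j j ^ 2)) := by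
  rw [merit_eq K β w hU, lamObjective]
  have : ∑ i, (lam i - (U.transpose * lap w * U) i i) ^ 2 = ∑ j, lam j ^ 2
      - 2 * ∑ j, lam j * (U.transpose * lap w * U) j j
      + ∑ j, (U.transpose * lap w * U) j j ^ 2 := by
    rw [Finset.mul_sum, ← Finset.sum_sub_distrib, ← Finset.sum_add_distrib]
    exact Finset.sum_congr rfl fun j _ => by ring
  rw [this]
  ring

/-! ### The generalized determinant -/

-- The characteristic polynomials of `U Diag(λ) Uᵀ` and of the invertible `q × q` matrix `Diag(λ) Uᵀ
-- U` agree up to powers of `X`, so the nonzero eigenvalues multiply to the determinant of the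
-- latter. Non-orthonormal `U` must be covered because the Lagrangian is differentiated in all
-- directions.
open Polynomial in
theorem gdet_spec {p q : ℕ} {U : Matrix (Fin p) (Fin q) ℝ} {lam : Fin q → ℝ}
    (hU : (U.transpose * U).det ≠ 0) (hlam : ∀ i, lam i ≠ 0) :
    gdet (spec_isHermitian U lam) = (U.transpose * U).det * ∏ i, lam i := by
  set hA := spec_isHermitian U lam
  set ev := hA.eigenvalues
  set M := Matrix.diagonal lam * (U.transpose * U) with hM
  have hdet : M.det = (U.transpose * U).det * ∏ i, lam i := by
    rw [hM, Matrix.det_mul, Matrix.det_diagonal, mul_comm]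
  have hdet0 : M.det ≠ 0 := by
    rw [hdet]
    exact mul_ne_zero hU (Finset.prod_ne_zero_iff.2 fun i _ => hlam i)
  have hcomm : (X : ℝ[X]) ^ q * (spec U lam).charpoly = X ^ p * M.charpoly := by
    have := Matrix.charpoly_mul_comm' U (Matrix.diagonal lam * U.transpose)
    simpa [spec, hM, Matrix.mul_assoc] using this
  have hchar : (spec U lam).charpoly = ∏ i, (X - C (ev i)) := by simpa using hA.charpoly_eq
  set Z := Finset.univ.filter fun i => ev i = 0
  set N := Finset.univ.filter fun i => ¬ev i = 0
  set R : ℝ[X] := ∏ i ∈ N, (X - C (ev i)) with hR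
  have hsplit : (spec U lam).charpoly = X ^ Z.card * R := by
    rw [hchar, ← Finset.prod_filter_mul_prod_filter_not Finset.univ (fun i => ev i = 0)]
    congr 1
    rw [Finset.prod_congr rfl (g := fun _ => X) fun i hi => by
      rw [(Finset.mem_filter.1 hi).2, C_0, sub_zero], Finset.prod_const]
  have hR0 : R.coeff 0 = (-1) ^ N.card * ∏ i ∈ N, ev i := by
    rw [hR, coeff_zero_eq_eval_zero, eval_prod]
    simp [Finset.prod_neg]
  have hRne : R.coeff 0 ≠ 0 := by
    rw [hR0]
    exact mul_ne_zero (pow_ne_zero _ (by norm_num))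
      (Finset.prod_ne_zero_iff.2 fun i hi => (Finset.mem_filter.1 hi).2)
  have hM0 : M.charpoly.coeff 0 = (-1) ^ q * M.det := by
    rw [Matrix.det_eq_sign_charpoly_coeff M, Fintype.card_fin, ← mul_assoc, ← mul_pow]
    simp
  have hMne : M.charpoly.coeff 0 ≠ 0 := by
    rw [hM0]; exact mul_ne_zero (pow_ne_zero _ (by norm_num)) hdet0
  have htr : ∀ (n : ℕ) (Q : ℝ[X]), Q.coeff 0 ≠ 0 → (X ^ n * Q).natTrailingDegree = n := by
    intro n Q hQ
    have hQ0 : Q ≠ 0 := by rintro rfl; simp at hQ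
    rw [mul_comm, natTrailingDegree_mul_X_pow hQ0]
    have := natTrailingDegree_le_of_ne_zero hQ
    omega
  have heq : (X : ℝ[X]) ^ (q + Z.card) * R = X ^ p * M.charpoly := by
    rw [← hcomm, hsplit, pow_add, mul_assoc]
  -- Comparing the orders of vanishing at `0` counts the zero eigenvalues, as both cofactors have
  -- nonzero constant term.
  have hcard : q + Z.card = p := by
    rw [← htr (q + Z.card) R hRne, heq, htr _ _ hMne]
  have hN : N.card = q := by
    have : Z.card + N.card = p := by
      rw [Finset.card_filter_add_card_filter_not, Finset.card_univ, Fintype.card_fin]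
    omega
  rw [hcard] at heq
  have hRM : R = M.charpoly := mul_left_cancel₀ (pow_ne_zero _ X_ne_zero) heq
  have hfin : ∏ i ∈ N, ev i = M.det := by
    have h1 : (-1 : ℝ) ^ q * ∏ i ∈ N, ev i = (-1) ^ q * M.det := by
      rw [← hM0, ← hRM, hR0, hN]
    exact mul_left_cancel₀ (pow_ne_zero _ (by norm_num)) h1
  rw [← hdet, ← hfin, gdet, Finset.prod_filter]
  exact Finset.prod_congr rfl fun i _ => by
    simp only [ite_not, ev]

theorem objective_eq {p q : ℕ} (K : Matrix (Fin p) (Fin p) ℝ) (β : ℝ) {x : State p q}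
    (hU : (x.2.1.transpose * x.2.1).det ≠ 0) (hlam : ∀ i, x.2.2 i ≠ 0) :
    objective K β x =
      -Real.log (x.2.1.transpose * x.2.1).det + merit K β x.1 x.2.1 x.2.2 := by
  rw [objective, gdet_spec hU hlam, Real.log_mul hU (Finset.prod_ne_zero_iff.2 fun i _ => hlam i),
    Real.log_prod fun i _ => hlam i, trace_mul_lap, merit]
  ring

/-! ### Multipliers for the chain of inequalities -/

/-- The ends `c₁`, `c₂` do not move, so the chain of a direction has ends `0`. -/
theorem chain_add_smul {q : ℕ} (c₁ c₂ : ℝ) (lam η : Fin q → ℝ) (t : ℝ) (n : Fin (q + 2)) :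
    chain c₁ c₂ (lam + t • η) n = chain c₁ c₂ lam n + t * chain 0 0 η n := by
  induction n using Fin.cases with
  | zero => simp [chain]
  | succ n =>
    induction n using Fin.lastCases with
    | last => simp [chain]
    | cast n => simp [chain]

theorem chain_castSucc_succ {q : ℕ} (c₁ c₂ : ℝ) (lam : Fin q → ℝ) (j : Fin q) :
    chain c₁ c₂ lam j.castSucc.succ = lam j := by
  simp [chain]

theorem chain_zero {q : ℕ} (c₁ c₂ : ℝ) (lam : Fin q → ℝ) : chain c₁ c₂ lam 0 = c₁ := rfl

theorem chain_last {q : ℕ} (c₁ c₂ : ℝ) (lam : Fin q → ℝ) :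
    chain c₁ c₂ lam (Fin.last (q + 1)) = c₂ := by
  rw [← Fin.succ_last]; simp [chain]

/-- Summation by parts; the boundary terms vanish because the ends are `0`. -/
theorem sum_mul_chain_sub {q : ℕ} (μ : Fin (q + 1) → ℝ) (η : Fin q → ℝ) :
    ∑ i : Fin (q + 1), μ i * (chain 0 0 η i.castSucc - chain 0 0 η i.succ) =
      ∑ j : Fin q, η j * (μ j.succ - μ j.castSucc) := by
  simp only [mul_sub, Finset.sum_sub_distrib]
  rw [Fin.sum_univ_succ, Fin.sum_univ_castSucc (fun i : Fin (q + 1) => μ i * chain 0 0 η i.succ)]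
  have h1 : ∀ j : Fin q, chain 0 0 η j.succ.castSucc = η j := fun j => by
    rw [← Fin.succ_castSucc, chain_castSucc_succ]
  simp only [h1, chain_castSucc_succ, Fin.castSucc_zero, chain_zero, Fin.succ_last, chain_last]
  simp [mul_comm]

/-- Along this direction the gap of the chain at `i` shrinks, the gap at `m` grows at the same rate,
and all others stay fixed. -/
theorem chain_indicator {q : ℕ} (i m : Fin (q + 1)) (n : Fin (q + 2)) :
    chain 0 0 (fun j : Fin q => (if (j : ℕ) < i then (1 : ℝ) else 0) - if (j : ℕ) < m then 1 else 0)
      n = (if (n : ℕ) ≤ i then (1 : ℝ) else 0) - if (n : ℕ) ≤ m then 1 else 0 := by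
  induction n using Fin.cases with
  | zero => simp [chain]
  | succ n =>
    induction n using Fin.lastCases with
    | last =>
      have := i.2
      have := m.2
      rw [Fin.succ_last, chain_last, if_neg (by simp; omega), if_neg (by simp; omega), sub_zero]
    | cast n => rw [chain_castSucc_succ]; simp

/-- Multipliers for a minimum over `Slam`, from the first-order condition in the feasible
directions. -/
theorem exists_chain_multipliers {q : ℕ} {c₁ c₂ : ℝ} {lam g : Fin q → ℝ}
    (hlam : lam ∈ Slam c₁ c₂)
    (hg : ∀ η : Fin q → ℝ, (∀ᶠ t in 𝓝[>] (0 : ℝ), lam + t • η ∈ Slam c₁ c₂) →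
      0 ≤ ∑ j, η j * g j) :
    ∃ μ : Fin (q + 1) → ℝ, (∀ i, 0 ≤ μ i) ∧
      (∀ i, μ i * (chain c₁ c₂ lam i.castSucc - chain c₁ c₂ lam i.succ) = 0) ∧
      ∀ j : Fin q, μ j.succ - μ j.castSucc = -g j := by
  -- Partial sums of `g`. The required recursion determines the multipliers as a constant minus `G`;
  -- the constant `max G` makes them nonnegative, and `key` makes them vanish at slack constraints.
  set G : Fin (q + 1) → ℝ := fun i => ∑ j : Fin q, (if (j : ℕ) < i then 1 else 0) * g j with hG
  have key : ∀ i m : Fin (q + 1), chain c₁ c₂ lam i.castSucc < chain c₁ c₂ lam i.succ →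
      G m ≤ G i := by
    intro i m hi
    -- Transferring length from the open gap `i` to the gap `m` is feasible for steps shorter than
    -- gap `i`.
    have h := hg (fun j : Fin q =>
      (if (j : ℕ) < i then (1 : ℝ) else 0) - if (j : ℕ) < m then 1 else 0) ?_
    · simp only [sub_mul, Finset.sum_sub_distrib] at h
      simp only [hG]
      linarith
    · have hgap : 0 < chain c₁ c₂ lam i.succ - chain c₁ c₂ lam i.castSucc := sub_pos.2 hi
      filter_upwards [Ioo_mem_nhdsGT hgap] with t ht l
      rw [chain_add_smul, chain_add_smul, chain_indicator, chain_indicator]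
      have hl := hlam l
      simp only [Fin.val_castSucc, Fin.val_succ]
      by_cases hli : l = i
      · subst hli
        have h0 : ¬(l : ℕ) + 1 ≤ l := by omega
        simp only [le_refl, if_true, h0, if_false]
        have h1 : (if (l : ℕ) + 1 ≤ m then (1 : ℝ) else 0) ≤ if (l : ℕ) ≤ m then 1 else 0 := by
          split_ifs <;> first | omega | norm_num
        nlinarith [ht.1, ht.2, mul_le_mul_of_nonneg_left h1 ht.1.le]
      · have hne : (l : ℕ) ≠ i := fun h => hli (Fin.ext h)
        have h1 : (if (l : ℕ) ≤ i then (1 : ℝ) else 0) - (if (l : ℕ) ≤ m then 1 else 0) ≤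
            (if (l : ℕ) + 1 ≤ i then (1 : ℝ) else 0) - if (l : ℕ) + 1 ≤ m then 1 else 0 := by
          split_ifs <;> first | omega | norm_num
        nlinarith [mul_le_mul_of_nonneg_left h1 ht.1.le]
  obtain ⟨m, hm⟩ := Finite.exists_max G
  refine ⟨fun i => G m - G i, fun i => sub_nonneg.2 (hm i), fun i => ?_, fun j => ?_⟩
  · beta_reduce
    rcases (hlam i).lt_or_eq with h | h
    · rw [le_antisymm (hm i) (key i m h)]; simp
    · rw [h]; simp
  · have : G j.succ - G j.castSucc = g j := by
      simp only [hG, ← Finset.sum_sub_distrib, ← sub_mul, Fin.val_succ, Fin.val_castSucc]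
      rw [Finset.sum_eq_single j]
      · simp
      · intro b _ hb
        have : (b : ℕ) ≠ j := fun h => hb (Fin.ext h)
        have : ((b : ℕ) < j + 1) ↔ (b : ℕ) < j := by omega
        simp [this]
      · simp
    linarith

/-! ### Directional derivatives -/

theorem hasDerivAt_quadratic (a b c : ℝ) :
    HasDerivAt (fun t : ℝ => a + t * b + t ^ 2 * c) b 0 := by
  have h := (((hasDerivAt_id (0 : ℝ)).mul_const b).const_add a).fun_add
    (((hasDerivAt_id (0 : ℝ)).fun_pow 2).mul_const c)
  simpa using h

theorem hasDerivAt_lamObjective {p q : ℕ} (β : ℝ) (w : Edge p → ℝ) (U : Matrix (Fin p) (Fin q) ℝ)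
    {lam : Fin q → ℝ} (hlam : ∀ i, lam i ≠ 0) (η : Fin q → ℝ) :
    HasDerivAt (fun t : ℝ => lamObjective β w U (lam + t • η))
      (∑ j, η j * (-(lam j)⁻¹ + β * (lam j - (U.transpose * lap w * U) j j))) 0 := by
  have hlin : ∀ j, HasDerivAt (fun t : ℝ => (lam + t • η) j) (η j) 0 := by
    intro j
    simpa using ((hasDerivAt_id (0 : ℝ)).mul_const (η j)).const_add (lam j)
  have hlog : ∀ j, HasDerivAt (fun t : ℝ => Real.log ((lam + t • η) j)) (η j / lam j) 0 := by
    intro j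
    simpa using (hlin j).log (by simpa using hlam j)
  have hsq : ∀ j, HasDerivAt (fun t : ℝ => ((lam + t • η) j - (U.transpose * lap w * U) j j) ^ 2)
      (2 * (lam j - (U.transpose * lap w * U) j j) * η j) 0 := by
    intro j
    simpa using ((hlin j).sub_const ((U.transpose * lap w * U) j j)).fun_pow 2
  have h := (HasDerivAt.fun_sum fun j (_ : j ∈ Finset.univ) => hlog j).fun_neg.fun_add
    ((HasDerivAt.fun_sum fun j (_ : j ∈ Finset.univ) => hsq j).const_mul (β / 2))
  refine h.congr_deriv ?_
  rw [Finset.mul_sum, ← Finset.sum_neg_distrib, ← Finset.sum_add_distrib]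
  refine Finset.sum_congr rfl fun j _ => ?_
  ring

theorem nonneg_of_hasDerivAt_of_eventually_le {φ : ℝ → ℝ} {φ' : ℝ} (h : HasDerivAt φ φ' 0)
    (hle : ∀ᶠ t in 𝓝[>] (0 : ℝ), φ 0 ≤ φ t) : 0 ≤ φ' := by
  refine ge_of_tendsto h.tendsto_slope_zero_right ?_
  filter_upwards [hle, self_mem_nhdsWithin] with t ht ht0
  have : (0 : ℝ) < t := ht0
  simp only [zero_add, smul_eq_mul]
  exact mul_nonneg (by positivity) (sub_nonneg.2 ht)

theorem spec_add_smul {p q : ℕ} (U H : Matrix (Fin p) (Fin q) ℝ) (lam : Fin q → ℝ) (t : ℝ) :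
    spec (U + t • H) lam = spec U lam + t • (H * Matrix.diagonal lam * U.transpose
      + U * Matrix.diagonal lam * H.transpose) + t ^ 2 • spec H lam := by
  simp only [spec, Matrix.transpose_add, Matrix.transpose_smul, Matrix.add_mul, Matrix.mul_add,
    Matrix.smul_mul, Matrix.mul_smul, smul_add, smul_smul, pow_two]
  abel

theorem hasDerivAt_frobSq_quadratic {p : ℕ} (A B C : Matrix (Fin p) (Fin p) ℝ) :
    HasDerivAt (fun t : ℝ => frobSq (A + t • B + t ^ 2 • C)) (2 * ∑ i, ∑ j, B i j * A i j) 0 := by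
  have h : ∀ i j, HasDerivAt (fun t : ℝ => (A + t • B + t ^ 2 • C) i j ^ 2)
      (2 * (B i j * A i j)) 0 := by
    intro i j
    refine ((hasDerivAt_quadratic (A i j) (B i j) (C i j)).fun_pow 2).congr_deriv ?_
    simp; ring
  have h2 := HasDerivAt.fun_sum fun i (_ : i ∈ Finset.univ) =>
    HasDerivAt.fun_sum fun j (_ : j ∈ Finset.univ) => h i j
  refine h2.congr_deriv ?_
  simp only [Finset.mul_sum]

theorem differentiable_matrix_apply {m n : ℕ} (i : Fin m) (j : Fin n) :
    Differentiable ℝ fun A : Matrix (Fin m) (Fin n) ℝ => A i j :=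
  (LinearMap.toContinuousLinearMap (Matrix.entryLinearMap ℝ ℝ i j)).differentiable

theorem differentiable_det_of_apply {E : Type*} [NormedAddCommGroup E] [NormedSpace ℝ E] {n : ℕ}
    {M : E → Matrix (Fin n) (Fin n) ℝ} (hM : ∀ i j, Differentiable ℝ fun z => M z i j) :
    Differentiable ℝ fun z => (M z).det := by
  simp only [Matrix.det_apply']
  refine Differentiable.fun_sum fun σ _ => (Differentiable.const_mul ?_ _)
  have h (i : Fin n) := hM (σ i) i
  fun_prop

/-- Jacobi's formula at the identity: the first-order expansion of `det (1 + t B)` gives the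
derivative of `det` on `B`, and the curve has tangent `B` at `0`. -/
theorem hasDerivAt_det_quadratic {n : ℕ} (B C : Matrix (Fin n) (Fin n) ℝ) :
    HasDerivAt (fun t : ℝ => (1 + t • B + t ^ 2 • C).det) B.trace 0 := by
  have hd := (differentiable_det_of_apply (M := fun A : Matrix (Fin n) (Fin n) ℝ => A)
    differentiable_matrix_apply 1).hasFDerivAt
  have htr : fderiv ℝ (fun A : Matrix (Fin n) (Fin n) ℝ => A.det) 1 B = B.trace := by
    refine (hd.hasLineDerivAt B).unique ?_
    have h (P : Polynomial ℝ) :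
        HasDerivAt (fun t : ℝ => 1 + B.trace * t + P.eval t * t ^ 2) B.trace 0 := by
      simpa using (((hasDerivAt_id (0 : ℝ)).const_mul B.trace).const_add 1).fun_add
        ((P.hasDerivAt (0 : ℝ)).fun_mul ((hasDerivAt_id (0 : ℝ)).fun_pow 2))
    have h1 : HasDerivAt (fun t : ℝ => (1 + t • B).det) B.trace 0 := by
      rw [funext fun t => Matrix.det_one_add_smul t B]
      exact h _
    exact h1
  have hc : HasDerivAt (fun t : ℝ => 1 + t • B + t ^ 2 • C) B 0 := by
    have h := (((hasDerivAt_id (0 : ℝ)).smul_const B).const_add 1).fun_add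
      (((hasDerivAt_id (0 : ℝ)).fun_pow 2).smul_const C)
    simp only [id, one_smul, mul_zero, zero_smul, add_zero, Nat.cast_ofNat,
      Nat.add_one_sub_one, pow_one, mul_one] at h
    exact h
  rw [← htr]
  have h0 : (1 : Matrix (Fin n) (Fin n) ℝ) + (0 : ℝ) • B + (0 : ℝ) ^ 2 • C = 1 := by simp
  exact HasFDerivAt.comp_hasDerivAt_of_eq (0 : ℝ) hd hc h0.symm

/-! ### Differentiability of the Lagrangian -/

section Differentiability

variable {p q : ℕ}

theorem differentiable_factor_apply (i : Fin p) (j : Fin q) :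
    Differentiable ℝ fun z : State p q => z.2.1 i j :=
  (differentiable_matrix_apply i j).comp (differentiable_fst.comp differentiable_snd)

theorem differentiable_lap_apply (i j : Fin p) :
    Differentiable ℝ fun z : State p q => lap z.1 i j :=
  ((LinearMap.toContinuousLinearMap
    (Matrix.entryLinearMap ℝ ℝ i j ∘ₗ lapLinear p)).differentiable).comp differentiable_fst

theorem differentiable_spec_apply (i j : Fin p) :
    Differentiable ℝ fun z : State p q => spec z.2.1 z.2.2 i j := by
  simp only [spec, Matrix.mul_apply (M := _ * _), Matrix.mul_diagonal, Matrix.transpose_apply]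
  have h := fun i j => differentiable_factor_apply (p := p) (q := q) i j
  fun_prop

theorem differentiable_gram_apply (i j : Fin q) :
    Differentiable ℝ fun z : State p q => (z.2.1.transpose * z.2.1) i j := by
  simp only [Matrix.mul_apply, Matrix.transpose_apply]
  have h := fun i j => differentiable_factor_apply (p := p) (q := q) i j
  fun_prop

theorem differentiable_det_gram :
    Differentiable ℝ fun z : State p q => (z.2.1.transpose * z.2.1).det :=
  differentiable_det_of_apply differentiable_gram_apply

theorem differentiableAt_merit (K : Matrix (Fin p) (Fin p) ℝ) (β : ℝ) {x : State p q}
    (hlam : ∀ i, x.2.2 i ≠ 0) :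
    DifferentiableAt ℝ (fun z : State p q => merit K β z.1 z.2.1 z.2.2) x := by
  simp only [merit, frobSq, Matrix.sub_apply]
  have h1 := fun i j => differentiable_lap_apply (p := p) (q := q) i j
  have h2 := fun i j => differentiable_spec_apply (p := p) (q := q) i j
  have h3 : ∀ i, DifferentiableAt ℝ (fun z : State p q => Real.log (z.2.2 i)) x := fun i =>
    DifferentiableAt.log (by fun_prop) (hlam i)
  fun_prop

theorem differentiable_chain (c₁ c₂ : ℝ) (n : Fin (q + 2)) :
    Differentiable ℝ fun z : State p q => chain c₁ c₂ z.2.2 n := by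
  induction n using Fin.cases with
  | zero => simp [chain]
  | succ n =>
    induction n using Fin.lastCases with
    | last => simp [chain]
    | cast n => simp only [chain_castSucc_succ]; fun_prop

theorem differentiable_ineqConstraint (c₁ c₂ : ℝ) (i : Edge p ⊕ Fin (q + 1)) :
    Differentiable ℝ fun z : State p q => ineqConstraint c₁ c₂ i z := by
  rcases i with e | i
  · simp only [ineqConstraint]; fun_prop
  · exact (differentiable_chain _ _ _).sub (differentiable_chain _ _ _)

theorem differentiable_eqConstraint (ij : Fin q × Fin q) :
    Differentiable ℝ fun z : State p q => eqConstraint ij z := by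
  simp only [eqConstraint, Matrix.sub_apply]
  exact (differentiable_gram_apply _ _).sub_const _

/-- Invertibility of `Uᵀ U` and nonvanishing of `λ` are open conditions, so the objective has a
differentiable expression on a full neighbourhood of a feasible point. -/
theorem eventually_objective_eq (K : Matrix (Fin p) (Fin p) ℝ) (β : ℝ) {x : State p q}
    (hU : x.2.1.transpose * x.2.1 = 1) (hlam : ∀ i, x.2.2 i ≠ 0) :
    ∀ᶠ z in 𝓝 x, objective K β z =
      -Real.log (z.2.1.transpose * z.2.1).det + merit K β z.1 z.2.1 z.2.2 := by
  have h1 : ∀ᶠ z : State p q in 𝓝 x, (z.2.1.transpose * z.2.1).det ≠ 0 :=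
    differentiable_det_gram.continuous.continuousAt.eventually_ne (by simp [hU])
  have h2 : ∀ᶠ z : State p q in 𝓝 x, ∀ i, z.2.2 i ≠ 0 :=
    eventually_all.2 fun i => ContinuousAt.eventually_ne
      (by fun_prop : ContinuousAt (fun z : State p q => z.2.2 i) x) (hlam i)
  filter_upwards [h1, h2] with z hz1 hz2 using objective_eq K β hz1 hz2

/-! ### Stationarity in each block of variables -/

theorem hasDerivAt_merit_weight (K : Matrix (Fin p) (Fin p) ℝ) {β : ℝ} (hβ : β ≠ 0)
    (w η : Edge p → ℝ) (U : Matrix (Fin p) (Fin q) ℝ) (lam : Fin q → ℝ) :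
    HasDerivAt (fun t : ℝ => merit K β (w + t • η) U lam)
      (β * ∑ e, η e * gradF K β w U lam e) 0 := by
  have h : ∀ t : ℝ, merit K β (w + t • η) U lam = merit K β w U lam
      + t * (β * ∑ e, η e * gradF K β w U lam e) + t ^ 2 * (β / 2 * frobSq (lap η)) := by
    intro t
    have h1 : frobSq (t • lap η) = t ^ 2 * frobSq (lap η) := by
      simp [frobSq, mul_pow, Finset.mul_sum]
    rw [merit_add K hβ, lap_smul, h1]
    simp only [Pi.smul_apply, smul_eq_mul, mul_assoc, ← Finset.mul_sum]
    ring
  rw [funext h]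
  exact hasDerivAt_quadratic _ _ _

theorem gram_add_smul (U H : Matrix (Fin p) (Fin q) ℝ) (t : ℝ) :
    (U + t • H).transpose * (U + t • H) = U.transpose * U
      + t • (U.transpose * H + H.transpose * U) + t ^ 2 • (H.transpose * H) := by
  simp only [Matrix.transpose_add, Matrix.transpose_smul, Matrix.add_mul, Matrix.mul_add,
    Matrix.smul_mul, Matrix.mul_smul, smul_add, smul_smul, pow_two]
  abel

theorem hasDerivAt_log_det_gram {U : Matrix (Fin p) (Fin q) ℝ} (hU : U.transpose * U = 1)
    (H : Matrix (Fin p) (Fin q) ℝ) :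
    HasDerivAt (fun t : ℝ => Real.log ((U + t • H).transpose * (U + t • H)).det)
      (2 * ∑ j, ∑ i, U i j * H i j) 0 := by
  simp only [gram_add_smul, hU]
  refine ((hasDerivAt_det_quadratic _ _).log (by simp)).congr_deriv ?_
  simp only [Matrix.trace, Matrix.diag, Matrix.add_apply, Matrix.mul_apply,
    Matrix.transpose_apply, Finset.sum_add_distrib, mul_comm (H _ _)]
  simp [two_mul]

/-- As `U` consists of eigenvectors, the residual maps it to `U` times a diagonal matrix. Hence `H`
enters only through its columnwise products with `U`, which multipliers of the diagonal constraints
can cancel. -/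
theorem hasDerivAt_merit_factor (K : Matrix (Fin p) (Fin p) ℝ) (β : ℝ) {w : Edge p → ℝ}
    {U : Matrix (Fin p) (Fin q) ℝ} {lam d : Fin q → ℝ} (hU : U.transpose * U = 1)
    (hA : lap w * U = U * Matrix.diagonal d) (H : Matrix (Fin p) (Fin q) ℝ) :
    HasDerivAt (fun t : ℝ => merit K β w (U + t • H) lam)
      (2 * β * ∑ j, (lam j ^ 2 - d j * lam j) * ∑ i, U i j * H i j) 0 := by
  set A := lap w with hAdef
  set B := H * Matrix.diagonal lam * U.transpose + U * Matrix.diagonal lam * H.transpose with hB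
  have hF : ∀ t : ℝ, frobSq (A - spec (U + t • H) lam) =
      frobSq ((A - spec U lam) + t • (-B) + t ^ 2 • (-spec H lam)) := by
    intro t
    rw [spec_add_smul]
    congr 1
    module
  simp only [merit, ← hAdef, hF]
  refine (((hasDerivAt_frobSq_quadratic (A - spec U lam) (-B) (-spec H lam)).const_mul
    (β / 2)).const_add _).congr_deriv ?_
  have hC : (A - spec U lam) * U = U * Matrix.diagonal (d - lam) := by
    rw [Matrix.sub_mul, hA, spec, Matrix.mul_assoc, hU, Matrix.mul_one, ← Matrix.mul_sub,
      Matrix.diagonal_sub]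
    rfl
  have hAs : (A - spec U lam).transpose = A - spec U lam := by
    rw [Matrix.transpose_sub, hAdef, lap_transpose]
    congr 1
    simpa [Matrix.IsHermitian, Matrix.conjTranspose_eq_transpose_of_trivial]
      using spec_isHermitian U lam
  have hCt : U.transpose * (A - spec U lam) = Matrix.diagonal (d - lam) * U.transpose := by
    have := congrArg Matrix.transpose hC
    rwa [Matrix.transpose_mul, Matrix.transpose_mul, hAs, Matrix.diagonal_transpose] at this
  have htr : ∑ i, ∑ j, B i j * (A - spec U lam) i j =
      2 * ∑ j, (d j - lam j) * lam j * ∑ i, U i j * H i j := by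
    have e1 : (H * Matrix.diagonal lam * U.transpose * (A - spec U lam)).trace =
        ∑ j, (d j - lam j) * lam j * ∑ i, U i j * H i j := by
      rw [Matrix.mul_assoc, hCt, Matrix.mul_assoc, Matrix.trace_mul_comm, ← Matrix.mul_assoc,
        Matrix.diagonal_mul_diagonal, Matrix.mul_assoc]
      simp only [Matrix.trace, Matrix.diag, Matrix.diagonal_mul]
      refine Finset.sum_congr rfl fun j _ => ?_
      simp only [Matrix.mul_apply, Matrix.transpose_apply, Pi.sub_apply]
      ring
    have e2 : (U * Matrix.diagonal lam * H.transpose * (A - spec U lam)).trace =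
        (H * Matrix.diagonal lam * U.transpose * (A - spec U lam)).trace := by
      rw [← Matrix.trace_transpose]
      simp only [Matrix.transpose_mul, Matrix.transpose_transpose, hAs, Matrix.diagonal_transpose]
      rw [Matrix.trace_mul_comm]
      simp only [Matrix.mul_assoc]
    have hBs : B.transpose = B := by
      simp only [hB, Matrix.transpose_add, Matrix.transpose_mul, Matrix.transpose_transpose,
        Matrix.diagonal_transpose, Matrix.mul_assoc]
      rw [add_comm]
    rw [sum_sum_mul_eq_trace, hBs, hB, Matrix.add_mul, Matrix.trace_add, e2, e1]
    ring
  have h3 : ∀ j, (lam j ^ 2 - d j * lam j) * ∑ i, U i j * H i j =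
      -((d j - lam j) * lam j * ∑ i, U i j * H i j) := fun j => by ring
  simp only [Matrix.neg_apply, neg_mul, Finset.sum_neg_distrib, htr, h3]
  ring

theorem hasDerivAt_gram_apply_self (U H : Matrix (Fin p) (Fin q) ℝ) (j : Fin q) :
    HasDerivAt (fun t : ℝ => ((U + t • H).transpose * (U + t • H) - 1 : Matrix _ _ ℝ) j j)
      (2 * ∑ i, U i j * H i j) 0 := by
  simp only [gram_add_smul]
  refine ((hasDerivAt_quadratic ((U.transpose * U) j j)
    ((U.transpose * H + H.transpose * U) j j) ((H.transpose * H) j j)).sub_const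
      ((1 : Matrix (Fin q) (Fin q) ℝ) j j)).congr_deriv ?_
  simp [Matrix.mul_apply, two_mul, mul_comm]

end Differentiability

/-- A triple fixed by the weight update, whose `U` consists of orthonormal eigenvectors of `𝓛w` and
whose `λ` minimizes the eigenvalue subproblem, is a KKT point. -/
theorem mem_kktSet_of_stationary {p q : ℕ} (hp : 0 < p) (K : Matrix (Fin p) (Fin p) ℝ)
    {β c₁ c₂ : ℝ} (hβ : 0 < β) (hc₁ : 0 < c₁) (hc : c₁ ≤ c₂) {w : Edge p → ℝ}
    {U : Matrix (Fin p) (Fin q) ℝ} {lam : Fin q → ℝ} (hw : wUpdate K β w U lam = w)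
    (hU : U.transpose * U = 1)
    (hA : lap w * U = U * Matrix.diagonal fun j => (U.transpose * lap w * U) j j)
    (hlam : lam ∈ Slam c₁ c₂) (hmin : IsMinOn (lamObjective β w U) (Slam c₁ c₂) lam) :
    ((w, U, lam) : State p q) ∈ kktSet K β c₁ c₂ := by
  have hpos : ∀ i, 0 < lam i := fun i => hc₁.trans_le (((mem_Slam_iff hc).1 hlam).2 i).1
  have hne : ∀ i, lam i ≠ 0 := fun i => (hpos i).ne'
  have hp' : (0 : ℝ) < p := by exact_mod_cast hp
  set d : Fin q → ℝ := fun j => (U.transpose * lap w * U) j j with hd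
  -- A fixed point of the projected gradient step satisfies the complementarity conditions.
  have hgrad : ∀ e, 0 ≤ w e ∧ 0 ≤ gradF K β w U lam e ∧ gradF K β w U lam e * w e = 0 := by
    intro e
    have h := congrFun hw e
    simp only [wUpdate] at h
    set g := gradF K β w U lam e
    have h2 : 0 < 1 / (2 * (p : ℝ)) := by positivity
    rcases le_total 0 (w e - 1 / (2 * (p : ℝ)) * g) with h1 | h1
    · rw [max_eq_left h1] at h
      have : g = 0 := by
        have h3 : 1 / (2 * (p : ℝ)) * g = 0 := by linarith
        exact (mul_eq_zero.1 h3).resolve_left h2.ne'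
      rw [this] at h1 ⊢
      exact ⟨by linarith, le_rfl, zero_mul _⟩
    · rw [max_eq_right h1] at h
      rw [← h] at h1 ⊢
      exact ⟨le_rfl, nonneg_of_mul_nonneg_right (by linarith) h2, mul_zero _⟩
  obtain ⟨μ, hμ0, hμs, hμg⟩ := exists_chain_multipliers
    (g := fun j => -(lam j)⁻¹ + β * (lam j - d j)) hlam (by
      intro η hη
      refine nonneg_of_hasDerivAt_of_eventually_le (hasDerivAt_lamObjective β w U hne η) ?_
      filter_upwards [hη] with t ht
      simpa using hmin ht)
  -- In the multiplier of `(Uᵀ U - I)_jj`, the `1` offsets the derivative of `-log det (Uᵀ U)` and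
  -- the other term that of the merit in `U`.
  refine ⟨?_, ?_, Sum.elim (fun e => β * gradF K β w U lam e) μ,
    fun ij => if ij.1 = ij.2 then 1 - β * (lam ij.1 ^ 2 - d ij.1 * lam ij.1) else 0, ?_, ?_, ?_⟩
  · rintro (e | i)
    · simpa [ineqConstraint] using (hgrad e).1
    · exact sub_nonpos.2 (hlam i)
  · intro ij
    simp [eqConstraint, hU]
  · rintro (e | i)
    · exact mul_nonneg hβ.le (hgrad e).2.1
    · exact hμ0 i
  · rintro (e | i)
    · simp [ineqConstraint, mul_assoc, (hgrad e).2.2]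
    · exact hμs i
  set ν : Fin q × Fin q → ℝ :=
    fun ij => if ij.1 = ij.2 then 1 - β * (lam ij.1 ^ 2 - d ij.1 * lam ij.1) else 0 with hν
  set x : State p q := (w, U, lam) with hx
  set M : Edge p ⊕ Fin (q + 1) → ℝ := Sum.elim (fun e => β * gradF K β w U lam e) μ with hM
  set Λ : State p q → ℝ := fun z =>
    (-Real.log (z.2.1.transpose * z.2.1).det + merit K β z.1 z.2.1 z.2.2)
      + ∑ i, M i * ineqConstraint c₁ c₂ i z + ∑ j, ν j * eqConstraint j z with hΛ
  have hev : (fun z : State p q => objective K β z + ∑ i, M i * ineqConstraint c₁ c₂ i z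
      + ∑ j, ν j * eqConstraint j z) =ᶠ[𝓝 x] Λ := by
    filter_upwards [eventually_objective_eq K β (x := x) hU hne] with z hz
    rw [hz]
  have hdiff : DifferentiableAt ℝ Λ x := by
    have h1 := differentiableAt_merit K β (x := x) hne
    have h2 : DifferentiableAt ℝ (fun z : State p q =>
        Real.log (z.2.1.transpose * z.2.1).det) x :=
      differentiable_det_gram.differentiableAt.log (by simp [hx, hU])
    have h3 := fun i => differentiable_ineqConstraint (p := p) (q := q) c₁ c₂ i
    have h4 := fun ij => differentiable_eqConstraint (p := p) (q := q) ij
    exact ((h2.neg.add h1).add (DifferentiableAt.fun_sum fun i _ => ((h3 i) x).const_mul _)).add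
      (DifferentiableAt.fun_sum fun i _ => ((h4 i) x).const_mul _)
  have hΛeq : ∀ z : State p q, Λ z =
      (-Real.log (z.2.1.transpose * z.2.1).det + merit K β z.1 z.2.1 z.2.2)
      + (-(β * ∑ e, z.1 e * gradF K β w U lam e)
        + ∑ i : Fin (q + 1), μ i * (chain c₁ c₂ z.2.2 i.castSucc - chain c₁ c₂ z.2.2 i.succ))
      + ∑ j, (1 - β * (lam j ^ 2 - d j * lam j)) *
        (z.2.1.transpose * z.2.1 - 1 : Matrix (Fin q) (Fin q) ℝ) j j := by
    intro z
    simp only [hΛ, Fintype.sum_sum_type, hM, Sum.elim_inl, Sum.elim_inr, ineqConstraint]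
    congr 1
    · congr 2
      rw [Finset.mul_sum, ← Finset.sum_neg_distrib]
      exact Finset.sum_congr rfl fun e _ => by ring
    · rw [Fintype.sum_prod_type]
      refine Finset.sum_congr rfl fun j _ => ?_
      simp [hν, eqConstraint]
  have hline : ∀ (v : State p q), HasDerivAt (fun t : ℝ => Λ (x + t • v)) 0 0 →
      fderiv ℝ Λ x v = 0 := fun v hv => (hdiff.hasFDerivAt.hasLineDerivAt v).unique hv
  refine HasFDerivAt.congr_of_eventuallyEq ?_ hev
  -- Differentiability of `Λ` being known, line derivatives in the three blocks of variables
  -- determine its derivative.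
  have hzero : fderiv ℝ Λ x = 0 := by
    refine ContinuousLinearMap.ext fun v => ?_
    have hv : v = ((v.1, 0, 0) : State p q) + ((0, v.2.1, 0) : State p q)
        + ((0, 0, v.2.2) : State p q) := by
      ext <;> simp
    rw [hv, map_add, map_add, hline (v.1, 0, 0), hline (0, v.2.1, 0), hline (0, 0, v.2.2)]
    · simp
    · simp only [hΛeq, hx, Prod.smul_mk, Prod.mk_add_mk, smul_zero, add_zero, chain_add_smul]
      have h1 := hasDerivAt_lamObjective β w U hne v.2.2
      have h2 : ∀ t : ℝ, ∑ i : Fin (q + 1), μ i *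
          (chain c₁ c₂ lam i.castSucc + t * chain 0 0 v.2.2 i.castSucc
            - (chain c₁ c₂ lam i.succ + t * chain 0 0 v.2.2 i.succ)) =
          ∑ i : Fin (q + 1), μ i * (chain c₁ c₂ lam i.castSucc - chain c₁ c₂ lam i.succ)
            + t * ∑ j, v.2.2 j * (μ j.succ - μ j.castSucc) := by
        intro t
        rw [← sum_mul_chain_sub, Finset.mul_sum, ← Finset.sum_add_distrib]
        exact Finset.sum_congr rfl fun i _ => by ring
      have h3 : HasDerivAt (fun t : ℝ => t * ∑ j, v.2.2 j * (μ j.succ - μ j.castSucc))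
          (∑ j, v.2.2 j * (μ j.succ - μ j.castSucc)) 0 := by
        simpa using (hasDerivAt_id (0 : ℝ)).mul_const (∑ j, v.2.2 j * (μ j.succ - μ j.castSucc))
      simp only [h2, merit_eq_lamObjective K β w hU]
      refine ((((h1.add_const _).const_add _).fun_add ((h3.const_add _).const_add _)).add_const
        _).congr_deriv ?_
      rw [← Finset.sum_add_distrib]
      exact Finset.sum_eq_zero fun j _ => by rw [hμg]; ring
    · simp only [hΛeq, hx, Prod.smul_mk, Prod.mk_add_mk, smul_zero, add_zero]
      have h1 := hasDerivAt_log_det_gram hU v.2.1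
      have h2 := hasDerivAt_merit_factor K β (lam := lam) hU hA v.2.1
      have h3 := HasDerivAt.fun_sum fun j (_ : j ∈ Finset.univ) =>
        (hasDerivAt_gram_apply_self U v.2.1 j).const_mul (1 - β * (lam j ^ 2 - d j * lam j))
      refine (((h1.fun_neg.fun_add h2).add_const _).fun_add h3).congr_deriv ?_
      rw [Finset.mul_sum, Finset.mul_sum, ← Finset.sum_neg_distrib, ← Finset.sum_add_distrib,
        ← Finset.sum_add_distrib]
      exact Finset.sum_eq_zero fun j _ => by ring
    · simp only [hΛeq, hx, Prod.smul_mk, Prod.mk_add_mk, smul_zero, add_zero]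
      have h1 := hasDerivAt_merit_weight K hβ.ne' w v.1 U lam
      have h2 : HasDerivAt (fun t : ℝ => ∑ e, (w + t • v.1) e * gradF K β w U lam e)
          (∑ e, v.1 e * gradF K β w U lam e) 0 := by
        refine HasDerivAt.fun_sum fun e _ => ?_
        simpa using (((hasDerivAt_id (0 : ℝ)).mul_const (v.1 e)).const_add (w e)).mul_const
          (gradF K β w U lam e)
      refine (((h1.const_add _).fun_add ((h2.const_mul β).fun_neg.add_const _)).add_const
        _).congr_deriv ?_
      ring
  have h := hdiff.hasFDerivAt
  rwa [hzero] at h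

/-! ### Boundedness of the iterates -/

theorem abs_apply_le_one {p q : ℕ} {U : Matrix (Fin p) (Fin q) ℝ} (hU : U.transpose * U = 1)
    (i : Fin p) (j : Fin q) : |U i j| ≤ 1 :=
  abs_le_one_iff_mul_self_le_one.2 <| by
    rw [← pow_two]
    exact (Finset.single_le_sum (f := fun j => U i j ^ 2) (fun _ _ => sq_nonneg _)
      (Finset.mem_univ j)).trans (sum_sq_row_le_one hU i)

theorem abs_spec_apply_le {p q : ℕ} {U : Matrix (Fin p) (Fin q) ℝ} (hU : U.transpose * U = 1)
    {lam : Fin q → ℝ} {c : ℝ} (hlam : ∀ i, |lam i| ≤ c) (i j : Fin p) :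
    |spec U lam i j| ≤ q * c := by
  have h : spec U lam i j = ∑ l, U i l * lam l * U j l := by
    rw [spec, Matrix.mul_apply]
    simp [Matrix.mul_diagonal]
  rw [h]
  refine (Finset.abs_sum_le_sum_abs _ _).trans ?_
  have : ∀ l ∈ Finset.univ, |U i l * lam l * U j l| ≤ c := by
    intro l _
    have hc : 0 ≤ c := (abs_nonneg _).trans (hlam l)
    rw [abs_mul, abs_mul]
    have h1 := mul_le_mul (abs_apply_le_one hU i l) (hlam l) (abs_nonneg _) zero_le_one
    have h2 := mul_le_mul h1 (abs_apply_le_one hU j l) (abs_nonneg _) (by linarith)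
    linarith
  simpa using Finset.sum_le_card_nsmul _ _ _ this

/-- A weight is minus an off-diagonal entry of `lap w`, so the residual norm and the bounded matrix
`spec U lam` control it. -/
theorem abs_weight_le {p q : ℕ} {w : Edge p → ℝ} {U : Matrix (Fin p) (Fin q) ℝ}
    (hU : U.transpose * U = 1) {lam : Fin q → ℝ} {c : ℝ} (hlam : ∀ i, |lam i| ≤ c) (e : Edge p) :
    |w e| ≤ Real.sqrt (frobSq (lap w - spec U lam)) + q * c := by
  have h1 : |(lap w - spec U lam) e.1.1 e.1.2| ≤ Real.sqrt (frobSq (lap w - spec U lam)) := by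
    refine Real.abs_le_sqrt ?_
    exact (Finset.single_le_sum (f := fun j => (lap w - spec U lam) e.1.1 j ^ 2)
      (fun _ _ => sq_nonneg _) (Finset.mem_univ e.1.2)).trans
      (Finset.single_le_sum (f := fun i => ∑ j, (lap w - spec U lam) i j ^ 2)
      (fun _ _ => Finset.sum_nonneg fun _ _ => sq_nonneg _) (Finset.mem_univ e.1.1))
  have h2 := abs_spec_apply_le hU hlam e.1.1 e.1.2
  rw [Matrix.sub_apply, lap_edge] at h1
  calc |w e| = |-((-w e - spec U lam e.1.1 e.1.2) + spec U lam e.1.1 e.1.2)| := by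
        congr 1; ring
    _ ≤ _ := by
        rw [abs_neg]
        exact (abs_add_le _ _).trans (add_le_add h1 h2)

/-- The linear term is nonnegative and can be dropped. The inequality serves twice: it bounds the
merit below, and it bounds the residual by the merit. -/
theorem le_merit {p q : ℕ} {K : Matrix (Fin p) (Fin p) ℝ} {β c₁ c₂ : ℝ}
    (hK : ∀ e, 0 ≤ lapAdj K e) (hc₁ : 0 < c₁) (hc : c₁ ≤ c₂) {w : Edge p → ℝ} (hw : 0 ≤ w)
    (U : Matrix (Fin p) (Fin q) ℝ) {lam : Fin q → ℝ} (hlam : lam ∈ Slam c₁ c₂) :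
    β / 2 * frobSq (lap w - spec U lam) - q * Real.log c₂ ≤ merit K β w U lam := by
  have h1 : ∑ i, Real.log (lam i) ≤ q * Real.log c₂ := by
    have : ∀ i ∈ Finset.univ, Real.log (lam i) ≤ Real.log c₂ := fun i _ =>
      Real.log_le_log (hc₁.trans_le (((mem_Slam_iff hc).1 hlam).2 i).1)
        (((mem_Slam_iff hc).1 hlam).2 i).2
    simpa using Finset.sum_le_card_nsmul _ _ _ this
  have h2 : 0 ≤ ∑ e, w e * lapAdj K e :=
    Finset.sum_nonneg fun e _ => mul_nonneg (hw e) (hK e)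
  rw [merit]
  linarith

theorem frobSq_nonneg {p : ℕ} (A : Matrix (Fin p) (Fin p) ℝ) : 0 ≤ frobSq A :=
  Finset.sum_nonneg fun _ _ => Finset.sum_nonneg fun _ _ => sq_nonneg _

/-! ### The iterates -/

namespace IsSGLSequence

variable {k q : ℕ} {K : Matrix (Fin (k + q)) (Fin (k + q)) ℝ} {β c₁ c₂ : ℝ}
  {w : ℕ → Edge (k + q) → ℝ} {U : ℕ → Matrix (Fin (k + q)) (Fin q) ℝ} {lam : ℕ → Fin q → ℝ}

/-- The starting point is arbitrary, so feasibility holds only from index `1` on; this explains the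
shifts in the following statements. -/
theorem weight_nonneg (h : IsSGLSequence K β c₁ c₂ w U lam) (t : ℕ) : 0 ≤ w (t + 1) := by
  intro e
  rw [h.w_step t]
  exact le_max_right _ _

theorem gram_eq_one (h : IsSGLSequence K β c₁ c₂ w U lam) (t : ℕ) :
    (U (t + 1)).transpose * U (t + 1) = 1 :=
  (h.U_step t).transpose_mul_self

/-- The previous `U` and `lam` are admissible competitors in the eigenvector and eigenvalue steps,
so those steps cannot undo the decrease gained by the weight step. -/
theorem merit_succ_le (h : IsSGLSequence K β c₁ c₂ w U lam) (hp : 0 < k + q) (hβ : 0 < β)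
    (hc₁ : 0 < c₁) (hc : c₁ ≤ c₂) (t : ℕ) :
    merit K β (w (t + 2)) (U (t + 2)) (lam (t + 2))
      + β * (k + q : ℕ) * ∑ e, (w (t + 2) e - w (t + 1) e) ^ 2
      ≤ merit K β (w (t + 1)) (U (t + 1)) (lam (t + 1)) := by
  have h1 := merit_wUpdate_le K hβ hp (h.weight_nonneg t) (U (t + 1)) (lam (t + 1))
  rw [← h.w_step (t + 1)] at h1
  have hS := (mem_Slam_iff hc).1 (h.lam_mem t)
  have h2 := merit_le_of_isTopEigenvectors K hβ (h.U_step (t + 1)) (h.gram_eq_one t) hS.1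
    (fun i => hc₁.le.trans (hS.2 i).1)
  have h3 := h.lam_min (t + 1) (h.lam_mem t)
  have h4 : merit K β (w (t + 2)) (U (t + 2)) (lam (t + 2)) ≤
      merit K β (w (t + 2)) (U (t + 2)) (lam (t + 1)) := by
    rw [merit_eq_lamObjective K β _ (h.gram_eq_one (t + 1)),
      merit_eq_lamObjective K β _ (h.gram_eq_one (t + 1))]
    exact add_le_add_left h3 _
  linarith

theorem antitone_merit (h : IsSGLSequence K β c₁ c₂ w U lam) (hp : 0 < k + q) (hβ : 0 < β)
    (hc₁ : 0 < c₁) (hc : c₁ ≤ c₂) :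
    Antitone fun t => merit K β (w (t + 1)) (U (t + 1)) (lam (t + 1)) := by
  refine antitone_nat_of_succ_le fun t => ?_
  have := h.merit_succ_le hp hβ hc₁ hc t
  have h2 : 0 ≤ β * (k + q : ℕ) * ∑ e, (w (t + 2) e - w (t + 1) e) ^ 2 :=
    mul_nonneg (by positivity) (Finset.sum_nonneg fun _ _ => sq_nonneg _)
  show merit K β (w (t + 2)) (U (t + 2)) (lam (t + 2)) ≤ _
  linarith

/-- A decreasing sequence bounded below has decrements tending to `0`, and these dominate the
squared weight changes. -/
theorem tendsto_weight_sub (h : IsSGLSequence K β c₁ c₂ w U lam) (hK : ∀ e, 0 ≤ lapAdj K e)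
    (hp : 0 < k + q) (hβ : 0 < β) (hc₁ : 0 < c₁) (hc : c₁ ≤ c₂) (e : Edge (k + q)) :
    Tendsto (fun t => w (t + 1) e - w t e) atTop (𝓝 0) := by
  set m : ℕ → ℝ := fun t => merit K β (w (t + 1)) (U (t + 1)) (lam (t + 1)) with hm
  have hbdd : BddBelow (Set.range m) := by
    refine ⟨-(q * Real.log c₂), ?_⟩
    rintro _ ⟨t, rfl⟩
    have h1 := le_merit (β := β) hK hc₁ hc (h.weight_nonneg t) (U (t + 1)) (h.lam_mem t)
    have h2 : 0 ≤ β / 2 * frobSq (lap (w (t + 1)) - spec (U (t + 1)) (lam (t + 1))) :=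
      mul_nonneg (by positivity) (frobSq_nonneg _)
    simp only [hm]
    linarith
  have hlim := tendsto_atTop_ciInf (h.antitone_merit hp hβ hc₁ hc) hbdd
  have hdiff : Tendsto (fun t => (m t - m (t + 1)) / (β * (k + q : ℕ))) atTop (𝓝 0) := by
    simpa using (hlim.sub (hlim.comp (tendsto_add_atTop_nat 1))).div_const (β * (k + q : ℕ))
  have hpos : 0 < β * (k + q : ℕ) := mul_pos hβ (by exact_mod_cast hp)
  have hsq : Tendsto (fun t => (w (t + 2) e - w (t + 1) e) ^ 2) atTop (𝓝 0) := by
    refine squeeze_zero (fun _ => sq_nonneg _) (fun t => ?_) hdiff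
    rw [le_div_iff₀ hpos]
    have h1 := h.merit_succ_le hp hβ hc₁ hc t
    have h2 := mul_le_mul_of_nonneg_left (Finset.single_le_sum
      (f := fun e => (w (t + 2) e - w (t + 1) e) ^ 2) (fun _ _ => sq_nonneg _)
      (Finset.mem_univ e)) hpos.le
    simp only [hm]
    linarith
  have habs : Tendsto (fun t => w (t + 2) e - w (t + 1) e) atTop (𝓝 0) := by
    have := hsq.sqrt
    simp only [Real.sqrt_sq_eq_abs, Real.sqrt_zero] at this
    exact (tendsto_zero_iff_abs_tendsto_zero _).2 this
  exact (tendsto_add_atTop_iff_nat (f := fun t => w (t + 1) e - w t e) 1).1 habs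

theorem exists_norm_le (h : IsSGLSequence K β c₁ c₂ w U lam) (hK : ∀ e, 0 ≤ lapAdj K e)
    (hp : 0 < k + q) (hβ : 0 < β) (hc₁ : 0 < c₁) (hc : c₁ ≤ c₂) :
    ∃ R, ∀ t, ‖((w (t + 1), U (t + 1), lam (t + 1)) : State (k + q) q)‖ ≤ R := by
  -- Bounds the squared residual: `le_merit` at a later index, combined with monotonicity of the
  -- merit from index `1`.
  set C := 2 / β * (merit K β (w 1) (U 1) (lam 1) + q * Real.log c₂) with hC
  have hc₂ : 0 < c₂ := hc₁.trans_le hc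
  have hlam : ∀ t i, |lam (t + 1) i| ≤ c₂ := by
    intro t i
    have := ((mem_Slam_iff hc).1 (h.lam_mem t)).2 i
    rw [abs_of_pos (hc₁.trans_le this.1)]
    exact this.2
  refine ⟨max (Real.sqrt C + q * c₂) (max 1 c₂), fun t => ?_⟩
  refine max_le_max ?_ (max_le_max ?_ ?_)
  · refine (pi_norm_le_iff_of_nonneg (by positivity)).2 fun e => ?_
    refine (abs_weight_le (h.gram_eq_one t) (hlam t) e).trans ?_
    gcongr
    have h1 := le_merit (β := β) hK hc₁ hc (h.weight_nonneg t) (U (t + 1)) (h.lam_mem t)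
    have h2 := h.antitone_merit hp hβ hc₁ hc (Nat.zero_le t)
    simp only [zero_add] at h2
    rw [hC, div_mul_eq_mul_div, le_div_iff₀ hβ]
    linarith
  · exact (Matrix.norm_le_iff zero_le_one).2 fun i j => abs_apply_le_one (h.gram_eq_one t) i j
  · exact (pi_norm_le_iff_of_nonneg hc₂.le).2 fun i => hlam t i

end IsSGLSequence

/-! ### Limit points -/

theorem continuous_wUpdate_apply {p q : ℕ} (K : Matrix (Fin p) (Fin p) ℝ) (β : ℝ) (e : Edge p) :
    Continuous fun z : State p q => wUpdate K β z.1 z.2.1 z.2.2 e := by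
  have hsub (i j : Fin p) : Continuous fun z : State p q => (lap z.1 - spec z.2.1 z.2.2) i j :=
    ((differentiable_lap_apply i j).sub (differentiable_spec_apply i j)).continuous
  have hadj : Continuous fun z : State p q => lapAdj (lap z.1 - spec z.2.1 z.2.2) e :=
    (((hsub _ _).sub (hsub _ _)).sub (hsub _ _)).add (hsub _ _)
  simp only [wUpdate, gradF_apply]
  fun_prop

theorem continuous_quadForm_apply {p q : ℕ} (i j : Fin q) :
    Continuous fun z : State p q => (z.2.1.transpose * lap z.1 * z.2.1) i j := by
  simp only [Matrix.mul_apply, Matrix.transpose_apply]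
  exact continuous_finsetSum _ fun l _ => (continuous_finsetSum _ fun m _ =>
    (differentiable_factor_apply m i).continuous.mul
      (differentiable_lap_apply m l).continuous).mul (differentiable_factor_apply l j).continuous

theorem continuousAt_lamObjective {p q : ℕ} (β : ℝ) {x : State p q} (hx : ∀ i, x.2.2 i ≠ 0) :
    ContinuousAt (fun z : State p q => lamObjective β z.1 z.2.1 z.2.2) x := by
  have hl (i : Fin q) : ContinuousAt (fun z : State p q => z.2.2 i) x := by fun_prop
  have hlog (i : Fin q) : ContinuousAt (fun z : State p q => Real.log (z.2.2 i)) x :=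
    (hl i).log (hx i)
  have hd (i : Fin q) := (continuous_quadForm_apply (p := p) i i).continuousAt (x := x)
  have h1 : ContinuousAt (fun z : State p q => ∑ i, Real.log (z.2.2 i)) x :=
    tendsto_finsetSum _ fun i _ => hlog i
  have h2 : ContinuousAt (fun z : State p q =>
      ∑ i, (z.2.2 i - (z.2.1.transpose * lap z.1 * z.2.1) i i) ^ 2) x :=
    tendsto_finsetSum _ fun i _ => ((hl i).sub (hd i)).pow 2
  exact h1.neg.add (h2.const_mul (β / 2))

theorem isClosed_Slam {q : ℕ} (c₁ c₂ : ℝ) (hc : c₁ ≤ c₂) : IsClosed (Slam (q := q) c₁ c₂) := by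
  have : Slam (q := q) c₁ c₂ =
      {lam | ∀ i j, i ≤ j → lam i ≤ lam j} ∩ {lam | ∀ i, c₁ ≤ lam i ∧ lam i ≤ c₂} := by
    ext lam
    exact mem_Slam_iff hc
  rw [this]
  refine IsClosed.inter ?_ ?_
  · simp only [Set.ofPred_forall]
    exact isClosed_iInter fun i => isClosed_iInter fun j => isClosed_iInter fun _ =>
      isClosed_le (continuous_apply i) (continuous_apply j)
  · simp only [Set.ofPred_forall, Set.ofPred_and]
    exact isClosed_iInter fun i => (isClosed_le continuous_const (continuous_apply i)).inter
      (isClosed_le (continuous_apply i) continuous_const)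

theorem IsSGLSequence.mem_kktSet_of_tendsto {k q : ℕ}
    {K : Matrix (Fin (k + q)) (Fin (k + q)) ℝ} {β c₁ c₂ : ℝ} {w : ℕ → Edge (k + q) → ℝ}
    {U : ℕ → Matrix (Fin (k + q)) (Fin q) ℝ} {lam : ℕ → Fin q → ℝ}
    (h : IsSGLSequence K β c₁ c₂ w U lam) (hK : ∀ e, 0 ≤ lapAdj K e)
    (hp : 0 < k + q) (hβ : 0 < β) (hc₁ : 0 < c₁) (hc : c₁ ≤ c₂) {ψ : ℕ → ℕ}
    (hψ : Tendsto ψ atTop atTop) {x : State (k + q) q}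
    (hx : Tendsto (fun n => ((w (ψ n), U (ψ n), lam (ψ n)) : State (k + q) q)) atTop (𝓝 x)) :
    x ∈ kktSet K β c₁ c₂ := by
  have hlim {f : State (k + q) q → ℝ} (hf : Continuous f) :
      Tendsto (fun n => f (w (ψ n), U (ψ n), lam (ψ n))) atTop (𝓝 (f x)) := (hf.tendsto x).comp hx
  have hev {P : ℕ → Prop} (hP : ∀ t, P (t + 1)) : ∀ᶠ n in atTop, P (ψ n) := by
    filter_upwards [hψ.eventually_ge_atTop 1] with n hn
    obtain ⟨t, ht⟩ := Nat.exists_eq_add_of_le' hn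
    rw [ht]
    exact hP t
  have hSlam : x.2.2 ∈ Slam c₁ c₂ :=
    (isClosed_Slam c₁ c₂ hc).mem_of_tendsto
      ((continuous_snd.comp continuous_snd).tendsto x |>.comp hx)
      (hev (P := fun t => lam t ∈ Slam c₁ c₂) h.lam_mem)
  have hne {l : Fin q → ℝ} (hl : l ∈ Slam c₁ c₂) (i : Fin q) : l i ≠ 0 :=
    (hc₁.trans_le (((mem_Slam_iff hc).1 hl).2 i).1).ne'
  have cU := fun i j => (differentiable_factor_apply (p := k + q) (q := q) i j).continuous
  have cL := fun i j => (differentiable_lap_apply (p := k + q) (q := q) i j).continuous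
  obtain ⟨w', U', lam'⟩ := x
  refine mem_kktSet_of_stationary hp K hβ hc₁ hc ?_ ?_ ?_ hSlam ?_
  -- The updated weights tend to the update of the limit by continuity, and to `w'` because
  -- consecutive weights differ by a null sequence.
  · ext e
    have h1 := hlim (continuous_wUpdate_apply K β e)
    simp only [← h.w_step] at h1
    have h2 := (h.tendsto_weight_sub hK hp hβ hc₁ hc e).comp hψ
    have h3 := hlim (f := fun z => z.1 e) (by fun_prop)
    refine tendsto_nhds_unique h1 ?_
    simpa using h2.add h3
  · ext i j
    refine tendsto_nhds_unique (hlim (differentiable_gram_apply i j).continuous) ?_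
    refine tendsto_const_nhds.congr' ?_
    filter_upwards [hev (P := fun t => (U t).transpose * U t = 1) h.gram_eq_one] with n hn
    rw [hn]
  · ext i j
    have e1 : Continuous fun z : State (k + q) q => (lap z.1 * z.2.1) i j := by
      simp only [Matrix.mul_apply]
      fun_prop
    have e2 : Continuous fun z : State (k + q) q => (z.2.1 * Matrix.diagonal fun j =>
        (z.2.1.transpose * lap z.1 * z.2.1) j j) i j := by
      simp only [Matrix.mul_diagonal]
      exact (cU i j).mul (continuous_quadForm_apply j j)
    refine tendsto_nhds_unique (hlim e1) ((hlim e2).congr' ?_)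
    filter_upwards [hev (P := fun t => lap (w t) * U t = U t * Matrix.diagonal fun j =>
      ((U t).transpose * lap (w t) * U t) j j) fun t => (h.U_step t).mul_eq] with n hn
    rw [← hn]
  -- The competitor `l` is kept fixed while the subproblem varies with `n`; entries at least `c₁ >
  -- 0` keep the logarithms continuous.
  · intro l hl
    have h1 := (continuousAt_lamObjective β (hne hSlam)).tendsto.comp hx
    have hcont : Continuous fun z : State (k + q) q => ((z.1, z.2.1, l) : State (k + q) q) := by
      fun_prop
    have h2 := (continuousAt_lamObjective β (x := (w', U', l)) (hne hl)).tendsto.comp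
      ((hcont.tendsto _).comp hx)
    exact le_of_tendsto_of_tendsto h1 h2 (hev
      (P := fun t => lamObjective β (w t) (U t) (lam t) ≤ lamObjective β (w t) (U t) l)
      fun t => h.lam_min t hl)

/-! ### Convergence to a set of limit points -/

/-- Every subsequence has, by compactness, a further one converging to a point of `s`, where the
continuous distance function vanishes. -/
theorem tendsto_infDist_of_subseq_limits {E : Type*} [PseudoMetricSpace E] {B s : Set E}
    (hB : IsCompact B) {x : ℕ → E} (hx : ∀ᶠ t in atTop, x t ∈ B)
    (hs : ∀ (ψ : ℕ → ℕ) (a : E), Tendsto ψ atTop atTop → Tendsto (x ∘ ψ) atTop (𝓝 a) → a ∈ s) :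
    Tendsto (fun t => Metric.infDist (x t) s) atTop (𝓝 0) := by
  refine tendsto_of_subseq_tendsto fun φ hφ => ?_
  obtain ⟨a, -, θ, hθ, ha⟩ := hB.tendsto_subseq' (hφ.eventually hx).frequently
  refine ⟨θ, ?_⟩
  have has := hs (φ ∘ θ) a (hφ.comp hθ.tendsto_atTop) ha
  have h := ((Metric.continuous_infDist_pt s).tendsto a).comp ha
  rwa [Metric.infDist_zero_of_mem has] at h

end SGL

/-! ### Convergence of the algorithm to the set of KKT points -/

theorem mainTheorem1 (k q : ℕ) (hk : 1 ≤ k)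
    (S : Matrix (Fin (k + q)) (Fin (k + q)) ℝ) (hS : S.PosSemidef)
    (α β c₁ c₂ : ℝ) (hα : 0 ≤ α) (hβ : 0 < β) (hc₁ : 0 < c₁) (hc : c₁ ≤ c₂)
    (w : ℕ → SGL.Edge (k + q) → ℝ) (U : ℕ → Matrix (Fin (k + q)) (Fin q) ℝ)
    (lam : ℕ → Fin q → ℝ)
    (hseq : SGL.IsSGLSequence (SGL.costMat S α) β c₁ c₂ w U lam) :
    (SGL.kktSet (p := k + q) (q := q) (SGL.costMat S α) β c₁ c₂).Nonempty ∧
    Tendsto (fun t => Metric.infDist ((w t, U t, lam t) : SGL.State (k + q) q)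
      (SGL.kktSet (SGL.costMat S α) β c₁ c₂)) atTop (𝓝 0) ∧
    ∀ x : SGL.State (k + q) q,
      MapClusterPt x atTop (fun t => ((w t, U t, lam t) : SGL.State (k + q) q)) →
        x ∈ SGL.kktSet (SGL.costMat S α) β c₁ c₂ := by
  have hp : 0 < k + q := by omega
  have hK := SGL.lapAdj_costMat_nonneg hS hα
  have hlimit : ∀ (ψ : ℕ → ℕ) (a : SGL.State (k + q) q), Tendsto ψ atTop atTop →
      Tendsto ((fun t => ((w t, U t, lam t) : SGL.State (k + q) q)) ∘ ψ) atTop (𝓝 a) →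
      a ∈ SGL.kktSet (SGL.costMat S α) β c₁ c₂ := fun ψ a hψ ha =>
    hseq.mem_kktSet_of_tendsto hK hp hβ hc₁ hc hψ ha
  obtain ⟨R, hR⟩ := hseq.exists_norm_le hK hp hβ hc₁ hc
  have : ProperSpace (SGL.State (k + q) q) := FiniteDimensional.proper_real _
  -- First countability makes a cluster point the limit of a subsequence.
  have : FirstCountableTopology (SGL.State (k + q) q) :=
    @UniformSpace.firstCountableTopology (SGL.State (k + q) q)
      PseudoMetricSpace.toUniformSpace EMetric.instIsCountablyGeneratedUniformity
  have hB : IsCompact (Metric.closedBall (0 : SGL.State (k + q) q) R) := isCompact_closedBall 0 R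
  have hmem : ∀ᶠ t in atTop,
      ((w t, U t, lam t) : SGL.State (k + q) q) ∈ Metric.closedBall 0 R := by
    filter_upwards [eventually_ge_atTop 1] with t ht
    obtain ⟨s, rfl⟩ := Nat.exists_eq_add_of_le' ht
    exact mem_closedBall_zero_iff.2 (hR s)
  -- `Metric.infDist` to the empty set is `0` by convention, so the distance claim carries content
  -- only together with nonemptiness, obtained from a convergent subsequence.
  refine ⟨?_, SGL.tendsto_infDist_of_subseq_limits hB hmem hlimit, fun x hx => ?_⟩
  · obtain ⟨a, -, ψ, hψ, ha⟩ := hB.tendsto_subseq' hmem.frequently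
    exact ⟨a, hlimit ψ a hψ.tendsto_atTop ha⟩
  · obtain ⟨ψ, hψ, ha⟩ := hx.tendsto_subseq
    exact hlimit ψ x hψ.tendsto_atTop ha
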